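/- Let $\mathcal H$ be a finite-dimensional complex Hilbert space and $\mathcal D$ its set of density operators. Let $\mathcal L$ be a Lindblad generator, $\mathcal L(X)=-i[K,X]+\sum_k\big(V_kXV_k^\dagger-\tfrac12\{V_k^\dagger V_k,X\}\big)$ with $K=K^\dagger$ and finitely many operators $V_k$, and write $\omega(t)=e^{t\mathcal L}(\omega)$. Let $\dot Q:\mathcal D\to\mathbb R\cup\{\infty\}$ be linear, i.e. $\dot Q((1-\lambda)\omega+\lambda\sigma)=(1-\lambda)\dot Q(\omega)+\lambda\dot Q(\sigma)$ for $\omega,\sigma\in\mathcal D$, $0<\lambda<1$. With $S(\omega)=-\mathrm{tr}\{\omega\ln\omega\}$, the EP rate at $\omega\in\mathcal D$ is $$\dot\Sigma(\omega)=\frac{d}{dt}S(\omega(t))\Big|_{t=0^+}+\dot Q(\omega)\in\mathbb R\cup\{\infty\},$$ the derivative being the limit, in the extended reals, of the one-sided difference quotients, and the integrated EP is $\Sigma(\omega,t)=\int_0^t\dot\Sigma(\omega(t'))\,dt'$. The relative entropy is $S(\rho\Vert\varphi)=\mathrm{tr}\{\rho(\ln\rho-\ln\varphi)\}$ if $\mathrm{supp}\,\rho\subseteq\mathrm{supp}\,\varphi$,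 and $\infty$ otherwise. Let $\varphi,\rho\in\mathcal D$ satisfy $\dot\Sigma(\varphi)<\infty$, $\dot\Sigma(\rho)<\infty$ and $S(\rho\Vert\varphi)<\infty$, and put $\varphi(\lambda)=(1-\lambda)\varphi+\lambda\rho$. Then: 1. Suppose that $\dot Q(e^{t\mathcal L}(\varphi))<\infty$ for all sufficiently small $t>0$ (which is automatic if $\dot Q$ is real-valued). Then for all sufficiently small $\lambda,t\ge0$ the EP rate is finite and integrable along the evolution of $\varphi(\lambda)$ on $[0,t]$, so that $\Sigma(\varphi(\lambda),t)$ is a finite integral; all one-sided derivatives below exist and are finite, the inner one on the right for all sufficiently small $t\ge0$; and $$\partial_\lambda^+\dot\Sigma(\varphi(\lambda))\big|_{\lambda=0}=\partial_t^+\Big(\partial_\lambda^+\Sigma(\varphi(\lambda),t)\big|_{\lambda=0}\Big)\Big|_{t=0}.$$ 2. If $\varphi\ge\alpha\rho$ for some $\alpha>0$, then there is a two-sided neighborhood of $\lambda=0$ on which $\varphi(\lambda)\in\mathcal D$ and $\lambda\mapsto\dot\Sigma(\varphi(\lambda))$ is finite and continuously differentiable. -/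

import Mathlib

open Filter Topology Set MeasureTheory

noncomputable section

namespace QuantumEP

variable {H : Type*} [NormedAddCommGroup H] [InnerProductSpace ℂ H] [CompleteSpace H]

/-- The trace of an operator on a (finite-dimensional) Hilbert space. -/
def opTrace (A : H →L[ℂ] H) : ℂ := LinearMap.trace ℂ H (A : H →ₗ[ℂ] H)

/-- Density operators: positive operators of unit trace. -/
def IsState (ω : H →L[ℂ] H) : Prop := ω.IsPositive ∧ opTrace ω = 1

/-- The support of a self-adjoint operator: the orthogonal complement of its kernel. -/
def supp (A : H →L[ℂ] H) : Submodule ℂ H := (LinearMap.ker (A : H →ₗ[ℂ] H))ᗮ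

/-- Von Neumann entropy `S(ω) = - tr (ω ln ω)`. The logarithm is taken with `ln 0 = 0`, which
implements the convention `0 ln 0 = 0`. -/
def entropy (ω : H →L[ℂ] H) : ℝ := -(opTrace (ω * CFC.log ω)).re

open Classical in
/-- Quantum relative entropy `S(ρ‖φ)`: equal to `tr (ρ (ln ρ - ln φ))` if
`supp ρ ⊆ supp φ`, and to `∞` otherwise. -/
def relEntropy (ρ φ : H →L[ℂ] H) : EReal :=
  if supp ρ ≤ supp φ then (((opTrace (ρ * (CFC.log ρ - CFC.log φ))).re : ℝ) : EReal) else ⊤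

/-- Generators in Lindblad form:
`𝓛(X) = -i [K, X] + ∑ₖ (Vₖ X Vₖ† - (1/2) {Vₖ† Vₖ, X})` with `K` self-adjoint. -/
def IsLindbladian (𝓛 : (H →L[ℂ] H) →L[ℂ] (H →L[ℂ] H)) : Prop :=
  ∃ (K : H →L[ℂ] H) (m : ℕ) (V : Fin m → (H →L[ℂ] H)), IsSelfAdjoint K ∧
    ∀ X : H →L[ℂ] H, 𝓛 X = -(Complex.I • (K * X - X * K)) +
      ∑ k, (V k * X * star (V k) -
        (1 / 2 : ℂ) • (star (V k) * V k * X + X * (star (V k) * V k)))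

/-- The time-evolved operator `e^{t𝓛}(ω)`. -/
def evolve (𝓛 : (H →L[ℂ] H) →L[ℂ] (H →L[ℂ] H)) (t : ℝ) (ω : H →L[ℂ] H) : H →L[ℂ] H :=
  NormedSpace.exp (t • 𝓛) ω

/-- The linear mixture `(1 - l) φ + l ρ`. -/
def mix (φ ρ : H →L[ℂ] H) (l : ℝ) : H →L[ℂ] H := (1 - l) • φ + l • ρ

/-- A linear functional on states with values in `ℝ ∪ {∞}`, i.e. one that is compatible with
convex mixtures. Only its values on states matter. -/
def IsEntropyFlow (Q : (H →L[ℂ] H) → EReal) : Prop :=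
  (∀ ω, IsState ω → Q ω ≠ ⊥) ∧
  ∀ ω σ, IsState ω → IsState σ → ∀ l : ℝ, 0 < l → l < 1 →
    Q (mix ω σ l) = ((1 - l : ℝ) : EReal) * Q ω + ((l : ℝ) : EReal) * Q σ

/-- Rate of entropy change `d/dt S(ω(t))` at `t = 0⁺`, where `ω(t) = e^{t𝓛}(ω)`: the limit, in the
extended reals, of the one-sided difference quotients. -/
def entropyRate (𝓛 : (H →L[ℂ] H) →L[ℂ] (H →L[ℂ] H)) (ω : H →L[ℂ] H) : EReal :=
  limUnder (𝓝[>] (0 : ℝ)) fun t : ℝ =>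
    (((entropy (evolve 𝓛 t ω) - entropy ω) / t : ℝ) : EReal)

/-- The entropy production rate: `d/dt S(ω(t))` plus the rate of entropy flow. -/
def epRate (𝓛 : (H →L[ℂ] H) →L[ℂ] (H →L[ℂ] H)) (Q : (H →L[ℂ] H) → EReal)
    (ω : H →L[ℂ] H) : EReal :=
  entropyRate 𝓛 ω + Q ω

/-- The EP rate at `ω` is a genuine real number: the one-sided time derivative of the entropy
exists as a real number, and the EP rate is finite. -/
def FiniteEPRate (𝓛 : (H →L[ℂ] H) →L[ℂ] (H →L[ℂ] H)) (Q : (H →L[ℂ] H) → EReal)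
    (ω : H →L[ℂ] H) : Prop :=
  DifferentiableWithinAt ℝ (fun t : ℝ => entropy (evolve 𝓛 t ω)) (Ici 0) 0 ∧
    epRate 𝓛 Q ω ≠ ⊥ ∧ epRate 𝓛 Q ω ≠ ⊤

/-- The integrated EP `∫₀ᵗ (EP rate at e^{s𝓛}(ω)) ds`, to be used where the integrand is
finite and integrable. -/
def integratedEP (𝓛 : (H →L[ℂ] H) →L[ℂ] (H →L[ℂ] H)) (Q : (H →L[ℂ] H) → EReal)
    (ω : H →L[ℂ] H) (t : ℝ) : ℝ :=
  ∫ s in (0 : ℝ)..t, (epRate 𝓛 Q (evolve 𝓛 s ω)).toReal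

/-- Symmetry of the one-sided partial derivatives at `l = 0`, `t = 0`. For small `l, t ≥ 0` the
integrated EP of `mix φ ρ l` up to time `t` is a genuine finite integral, its right derivative
`g t` in `l` at `l = 0` exists, and the right derivative of `g` at `t = 0` exists and coincides
with the right derivative of the EP rate of `mix φ ρ l` in `l` at `l = 0`. -/
def Condition1 (𝓛 : (H →L[ℂ] H) →L[ℂ] (H →L[ℂ] H)) (Q : (H →L[ℂ] H) → EReal)
    (φ ρ : H →L[ℂ] H) : Prop :=
  ∃ (τ ε d : ℝ) (g : ℝ → ℝ), 0 < τ ∧ 0 < ε ∧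
    (∀ l ∈ Icc (0 : ℝ) ε,
      (∀ s ∈ Icc (0 : ℝ) τ, FiniteEPRate 𝓛 Q (evolve 𝓛 s (mix φ ρ l))) ∧
      IntervalIntegrable (fun s => (epRate 𝓛 Q (evolve 𝓛 s (mix φ ρ l))).toReal)
        volume 0 τ) ∧
    HasDerivWithinAt (fun l => (epRate 𝓛 Q (mix φ ρ l)).toReal) d (Ici 0) 0 ∧
    (∀ t ∈ Icc (0 : ℝ) τ,
      HasDerivWithinAt (fun l => integratedEP 𝓛 Q (mix φ ρ l) t) (g t) (Ici 0) 0) ∧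
    HasDerivWithinAt g d (Ici 0) 0

/-- If `φ ≥ α ρ` for some `α > 0`, then for all `l` in a (two-sided) neighbourhood of `0`,
`mix φ ρ l` is a state with finite EP rate, and the EP rate is continuously differentiable in `l`
there. -/
def Condition2 (𝓛 : (H →L[ℂ] H) →L[ℂ] (H →L[ℂ] H)) (Q : (H →L[ℂ] H) → EReal)
    (φ ρ : H →L[ℂ] H) : Prop :=
  (∃ α : ℝ, 0 < α ∧ α • ρ ≤ φ) →
    ∃ ε : ℝ, 0 < ε ∧
      (∀ l ∈ Ioo (-ε) ε, IsState (mix φ ρ l) ∧ FiniteEPRate 𝓛 Q (mix φ ρ l)) ∧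
      ContDiffOn ℝ 1 (fun l => (epRate 𝓛 Q (mix φ ρ l)).toReal) (Ioo (-ε) ε)

end QuantumEP

end

/-! Let `N = kerProj φ` be the projection onto the kernel of `φ` and `τ` the real trace. If `τ (𝓛 φ
* N) ≠ 0`, weight flows into the kernel at first order and the entropy has slope `+∞`
(`tendsto_slope_map_mul_log_atTop`). A finite EP rate therefore means `τ (𝓛 φ * N) = 0` and `Q φ <
⊤`, and the entropy rate is then `-τ (𝓛 φ * log φ)`. Where `Q` is finite it agrees with a real
linear functional `q` (`IsEntropyFlow.exists_clm`). Finite relative entropy gives `supp ρ ≤ supp φ`,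
hence `ρ ≤ C • φ`, an inequality that the positive maps `e^{t𝓛}` preserve.

For small `|l|` the mixture keeps the kernel `N`, and its logarithm is that of the invertible
operator `mix φ ρ l + N`, a power series around `1`. This makes the EP rate continuously
differentiable in `l`, which is the second claim and the left side of the first.

The integrated EP is an entropy difference plus an integral of `q`. Its `l`-derivative at `0` is `-τ
(e^{t𝓛}(ρ - φ) * log (e^{t𝓛} φ))`, minus the same expression at time `0`, plus a smooth term. The
difficulty is to differentiate this at `t = 0`, since the support of `e^{t𝓛} φ` may grow as soon as
`t > 0`. But `N * 𝓛 φ * N = 0`, so only weight `O(t ^ 2)` enters the kernel, and logarithmic factors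
cannot spoil that. `hasDerivWithinAt_map_mul_log` proves it by a squeeze: operator monotonicity of
the logarithm bounds `τ (σ log γ)` from above (`exists_upper_bound`), Klein's inequality bounds `τ
(γ log γ)` from below, and the upper bound for `C • γ - σ` supplies the missing lower bound for `σ`.
The two mixed derivatives agree because the derivative of the logarithm is symmetric for the trace
form (`trace_mul_logDeriv`). -/

noncomputable section

namespace QuantumEP

/-! ### The logarithmic power series around `1` and its Fréchet derivative. -/

section LogSeries

variable {B : Type*} [NormedRing B]

lemma norm_pow_mul_le (x b : B) (i : ℕ) : ‖x ^ i * b‖ ≤ ‖x‖ ^ i * ‖b‖ := by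
  induction i with
  | zero => simp
  | succ k ih =>
    rw [pow_succ', mul_assoc, pow_succ', mul_assoc]
    exact (norm_mul_le _ _).trans (by gcongr)

lemma norm_mul_pow_le (x b : B) (i : ℕ) : ‖b * x ^ i‖ ≤ ‖b‖ * ‖x‖ ^ i := by
  induction i with
  | zero => simp
  | succ k ih =>
    rw [pow_succ, ← mul_assoc, pow_succ, ← mul_assoc]
    exact (norm_mul_le _ _).trans (by gcongr)

lemma ball_one_eq (r : ℝ) : {x : B | ‖1 - x‖ < r} = Metric.ball 1 r := by
  ext x; simp [dist_eq_norm, norm_sub_rev]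

variable [NormedAlgebra ℝ B]

open scoped RightActions in
/-- The map `b ↦ x ^ i * b * x ^ j`. -/
def sandwich (x : B) (i j : ℕ) : B →L[ℝ] B :=
  x ^ i •> ContinuousLinearMap.id ℝ B <• x ^ j

@[simp]
lemma sandwich_apply (x b : B) (i j : ℕ) : sandwich x i j b = x ^ i * b * x ^ j := by
  simp [sandwich]

lemma norm_sandwich_le (x : B) (i j : ℕ) : ‖sandwich x i j‖ ≤ ‖x‖ ^ (i + j) := by
  refine ContinuousLinearMap.opNorm_le_bound _ (by positivity) fun b => ?_
  rw [sandwich_apply]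
  calc _ ≤ ‖x ^ i * b‖ * ‖x‖ ^ j := norm_mul_pow_le _ _ _
    _ ≤ ‖x‖ ^ i * ‖b‖ * ‖x‖ ^ j := by gcongr; exact norm_pow_mul_le _ _ _
    _ = _ := by ring

/-- The derivative of the `n`-th term of the logarithmic series. -/
def logDerivTerm (x : B) (n : ℕ) : B →L[ℝ] B :=
  ((n : ℝ) + 1)⁻¹ • ∑ i ∈ Finset.range (n + 1), sandwich (1 - x) (n - i) i

/-- The logarithm as a power series around `1`. -/
def logSeries (x : B) : B := ∑' n : ℕ, -(((n : ℝ) + 1)⁻¹ • (1 - x) ^ (n + 1))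

/-- The Fréchet derivative of `logSeries`. -/
def logDeriv (x : B) : B →L[ℝ] B := ∑' n : ℕ, logDerivTerm x n

/-- The prefactor cancels the `n + 1` summands. The resulting geometric majorant serves both
termwise differentiation and continuity of the derivative. -/
lemma norm_logDerivTerm_le (x : B) (n : ℕ) : ‖logDerivTerm x n‖ ≤ ‖1 - x‖ ^ n := by
  rw [logDerivTerm, norm_smul, Real.norm_of_nonneg (by positivity)]
  have : ‖∑ i ∈ Finset.range (n + 1), sandwich (1 - x) (n - i) i‖ ≤
      ∑ i ∈ Finset.range (n + 1), ‖1 - x‖ ^ n := by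
    refine norm_sum_le_of_le _ fun i hi => (norm_sandwich_le _ _ _).trans ?_
    rw [Nat.sub_add_cancel (by simpa [Nat.lt_succ_iff] using hi)]
  rw [Finset.sum_const, Finset.card_range, nsmul_eq_mul] at this
  rw [inv_mul_le_iff₀ (by positivity)]
  exact_mod_cast this

lemma hasFDerivAt_logSeries_term (n : ℕ) (x : B) :
    HasFDerivAt (fun y : B => -(((n : ℝ) + 1)⁻¹ • (1 - y) ^ (n + 1))) (logDerivTerm x n) x := by
  have h := ((((hasFDerivAt_id (𝕜 := ℝ) x).const_sub (1 : B)).fun_pow' (n + 1)).const_smul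
    ((n : ℝ) + 1)⁻¹).neg
  refine h.congr_fderiv ?_
  ext b
  simp [logDerivTerm, ← smul_neg, ← Finset.sum_neg_distrib]

lemma continuous_logDerivTerm (n : ℕ) : Continuous fun x : B => logDerivTerm x n := by
  have h : ∀ i j : ℕ, Continuous fun x : B => sandwich (1 - x) i j := by
    intro i j
    have : (fun x : B => sandwich (1 - x) i j) = fun x =>
        ContinuousLinearMap.mulLeftRight ℝ B ((1 - x) ^ i) ((1 - x) ^ j) := by
      ext x b; simp
    rw [this]
    fun_prop
  unfold logDerivTerm
  fun_prop

variable [CompleteSpace B]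

lemma summable_logDerivTerm {x : B} (hx : ‖1 - x‖ < 1) : Summable (logDerivTerm x) :=
  Summable.of_norm_bounded (summable_geometric_of_lt_one (norm_nonneg _) hx)
    (norm_logDerivTerm_le x)

lemma hasFDerivAt_logSeries {x : B} (hx : ‖1 - x‖ < 1) :
    HasFDerivAt logSeries (logDeriv x) x := by
  obtain ⟨r, hxr, hr⟩ := exists_between hx
  have hr0 : 0 < r := (norm_nonneg _).trans_lt hxr
  refine hasFDerivAt_tsum_of_isPreconnected (s := Metric.ball (1 : B) r) (x₀ := 1)
    (summable_geometric_of_lt_one hr0.le hr) Metric.isOpen_ball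
    (convex_ball _ _).isPreconnected (fun n y _ => hasFDerivAt_logSeries_term n y) ?_
    (Metric.mem_ball_self hr0) ?_ ?_
  · intro n y hy
    rw [← ball_one_eq] at hy
    exact (norm_logDerivTerm_le y n).trans (by gcongr; exact le_of_lt hy)
  · simp
  · rwa [← ball_one_eq]

lemma continuousAt_logDeriv {x : B} (hx : ‖1 - x‖ < 1) :
    ContinuousAt (logDeriv : B → B →L[ℝ] B) x := by
  obtain ⟨r, hxr, hr⟩ := exists_between hx
  have hr0 : 0 < r := (norm_nonneg _).trans_lt hxr
  have : ContinuousOn (logDeriv : B → B →L[ℝ] B) (Metric.ball 1 r) := by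
    refine continuousOn_tsum (fun n => (continuous_logDerivTerm n).continuousOn)
      (summable_geometric_of_lt_one hr0.le hr) fun n y hy => ?_
    rw [← ball_one_eq] at hy
    exact (norm_logDerivTerm_le y n).trans (by gcongr; exact le_of_lt hy)
  exact this.continuousAt (Metric.isOpen_ball.mem_nhds (by rwa [← ball_one_eq]))

lemma map_logDeriv {E : Type*} [NormedAddCommGroup E] [NormedSpace ℝ E] {x : B}
    (hx : ‖1 - x‖ < 1) (f : B →L[ℝ] E) (b : B) :
    f (logDeriv x b) = ∑' n, f (logDerivTerm x n b) := by
  have := (summable_logDerivTerm hx)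
  exact (f.comp (ContinuousLinearMap.apply ℝ B b)).map_tsum this

/-- Termwise, cyclicity moves `(1 - x) ^ (n - i)` and `(1 - x) ^ i` to opposite sides of the other
factor, and reflecting `i ↦ n - i` restores the sum. This symmetry is what makes the mixed
derivatives agree. -/
lemma trace_mul_logDeriv {x : B} (hx : ‖1 - x‖ < 1) (τ : B →L[ℝ] ℝ)
    (hτ : ∀ a b, τ (a * b) = τ (b * a)) (a b : B) :
    τ (a * logDeriv x b) = τ (b * logDeriv x a) := by
  have h : ∀ a b : B, τ (a * logDeriv x b) = ∑' n, τ (a * logDerivTerm x n b) := fun a b =>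
    map_logDeriv hx (τ.comp (ContinuousLinearMap.mul ℝ B a)) b
  rw [h, h]
  congr 1
  ext n
  simp only [logDerivTerm, smul_apply, sum_apply,
    sandwich_apply, mul_smul_comm, map_smul, Finset.mul_sum, map_sum]
  congr 1
  rw [← Finset.sum_range_reflect]
  refine Finset.sum_congr rfl fun i hi => ?_
  have hi' : i ≤ n := by simpa [Nat.lt_succ_iff] using hi
  rw [show n + 1 - 1 - i = n - i by omega, show n - (n - i) = i by omega, ← mul_assoc, ← mul_assoc,
    ← mul_assoc, ← mul_assoc, mul_assoc _ b, hτ, ← mul_assoc]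

lemma mul_logDeriv {x N : B} (hx : ‖1 - x‖ < 1) (hN : Commute N x) (b : B) :
    N * logDeriv x b = logDeriv x (N * b) := by
  have h1 := map_logDeriv hx (ContinuousLinearMap.mul ℝ B N) b
  have h2 := map_logDeriv hx (ContinuousLinearMap.id ℝ B) (N * b)
  simp only [ContinuousLinearMap.mul_apply', ContinuousLinearMap.id_apply] at h1 h2
  rw [h1, h2]
  congr 1
  ext n
  simp only [logDerivTerm, smul_apply, sum_apply,
    sandwich_apply, mul_smul_comm, Finset.mul_sum]
  congr 1
  refine Finset.sum_congr rfl fun i _ => ?_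
  rw [← mul_assoc, ← mul_assoc, ← mul_assoc,
    (((Commute.one_right N).sub_right hN).pow_right (n - i)).eq]

lemma logDeriv_mul {x N : B} (hx : ‖1 - x‖ < 1) (hN : Commute N x) (b : B) :
    logDeriv x b * N = logDeriv x (b * N) := by
  have h1 := map_logDeriv hx ((ContinuousLinearMap.mul ℝ B).flip N) b
  have h2 := map_logDeriv hx (ContinuousLinearMap.id ℝ B) (b * N)
  simp only [ContinuousLinearMap.flip_apply, ContinuousLinearMap.mul_apply',
    ContinuousLinearMap.id_apply] at h1 h2
  rw [h1, h2]
  congr 1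
  ext n
  simp only [logDerivTerm, smul_apply, sum_apply, sandwich_apply, smul_mul_assoc, Finset.sum_mul]
  congr 1
  refine Finset.sum_congr rfl fun i _ => ?_
  rw [mul_assoc, mul_assoc, mul_assoc, mul_assoc,
    (((Commute.one_right N).sub_right hN).pow_right i).eq]

lemma hasDerivAt_logSeries_line {x : B} (hx : ‖1 - x‖ < 1) (b : B) :
    HasDerivAt (fun s : ℝ => logSeries (x + s • b)) (logDeriv x b) 0 := by
  have h : HasFDerivAt logSeries (logDeriv x) (x + (0 : ℝ) • b) := by
    simpa using hasFDerivAt_logSeries hx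
  have := h.comp_hasDerivAt (0 : ℝ) (((hasDerivAt_id (0 : ℝ)).smul_const b).const_add x)
  simpa [Function.comp_def] using this

lemma hasSum_logSeries {x : B} (hx : ‖1 - x‖ < 1) :
    HasSum (fun n : ℕ => -(((n : ℝ) + 1)⁻¹ • (1 - x) ^ (n + 1))) (logSeries x) := by
  refine Summable.hasSum (Summable.of_norm_bounded
    (summable_geometric_of_lt_one (norm_nonneg _) hx) fun n => ?_)
  rw [norm_neg, norm_smul, Real.norm_of_nonneg (by positivity)]
  calc _ ≤ 1 * ‖1 - x‖ ^ (n + 1) := by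
        gcongr
        · exact inv_le_one_of_one_le₀ (by linarith [Nat.cast_nonneg (α := ℝ) n])
        · exact norm_pow_le' _ n.succ_pos
    _ ≤ ‖1 - x‖ ^ n := by
        rw [one_mul]
        exact pow_le_pow_of_le_one (norm_nonneg _) hx.le n.le_succ

end LogSeries

/-! ### Agreement of the series with the functional calculus. -/

section CStar

variable {A : Type*} [CStarAlgebra A]

/-- The spectrum lies within `‖1 - a‖` of `1`, where the scalar series converges uniformly, and the
functional calculus respects uniform limits on the spectrum. -/
lemma log_eq_logSeries {a : A} (ha : IsSelfAdjoint a) (h1 : ‖1 - a‖ < 1) :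
    CFC.log a = logSeries a := by
  set r := ‖1 - a‖ with hr
  have hr0 : 0 ≤ r := norm_nonneg _
  have hspec : ∀ x ∈ spectrum ℝ a, |1 - x| ≤ r := by
    intro x hx
    have := norm_apply_le_norm_cfc (fun x : ℝ => 1 - x) a hx
    rwa [cfc_sub (fun _ => 1) (fun x => x) a, cfc_const_one ℝ a, cfc_id' ℝ a] at this
  have hF : ∀ n : ℕ,
      cfc (fun x : ℝ => ∑ i ∈ Finset.range n, -(((i : ℝ) + 1)⁻¹ * (1 - x) ^ (i + 1))) a
      = ∑ i ∈ Finset.range n, -(((i : ℝ) + 1)⁻¹ • (1 - a) ^ (i + 1)) := by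
    intro n
    rw [← Finset.sum_fn, cfc_sum _ a _ (fun i _ => by fun_prop)]
    refine Finset.sum_congr rfl fun i _ => ?_
    rw [cfc_neg, cfc_const_mul _ _ _, cfc_pow _ _ _, cfc_sub (fun _ => 1) (fun x => x) a,
      cfc_const_one ℝ a, cfc_id' ℝ a]
  refine tendsto_nhds_unique ?_ (hasSum_logSeries h1).tendsto_sum_nat
  simp_rw [← hF]
  refine tendsto_cfc_fun ?_ (.of_forall fun n => by fun_prop)
  rw [Metric.tendstoUniformlyOn_iff]
  intro ε hε
  have hlim : Tendsto (fun n : ℕ => r ^ (n + 1) / (1 - r)) atTop (𝓝 0) := by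
    simpa using (((tendsto_pow_atTop_nhds_zero_of_lt_one hr0 h1).comp
      (tendsto_add_atTop_nat 1)).div_const (1 - r))
  filter_upwards [hlim.eventually_lt_const hε] with n hn x hx
  refine lt_of_le_of_lt ?_ hn
  have h2 := hspec x hx
  have h3 := Real.abs_log_sub_add_sum_range_le (h2.trans_lt h1) n
  rw [sub_sub_cancel] at h3
  calc _ = |∑ i ∈ Finset.range n, (1 - x) ^ (i + 1) / ((i : ℝ) + 1) + Real.log x| := by
        rw [Real.dist_eq]
        congr 1
        rw [Finset.sum_neg_distrib, sub_neg_eq_add, add_comm]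
        congr 1
        exact Finset.sum_congr rfl fun i _ => by rw [div_eq_inv_mul]
    _ ≤ |1 - x| ^ (n + 1) / (1 - |1 - x|) := h3
    _ ≤ r ^ (n + 1) / (1 - r) := by
        have : 0 < 1 - r := by linarith
        gcongr

end CStar

/-! ### Kernel projections, supports and domination. -/

section KerProj

variable {A : Type*} [CStarAlgebra A]

/-- The spectral projection of a self-adjoint element onto the eigenvalue `x`. -/
def spectralProj (a : A) (x : ℝ) : A := cfc (fun y : ℝ => if y = x then 1 else 0) a

/-- The spectral projection onto the kernel. -/
def kerProj (a : A) : A := spectralProj a 0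

variable [FiniteDimensional ℂ A]

lemma finite_spectrum_real (a : A) : (spectrum ℝ a).Finite := by
  have hint : IsIntegral ℝ a := by
    have : FiniteDimensional ℝ A := FiniteDimensional.complexToReal A
    exact IsIntegral.of_finite ℝ a
  obtain ⟨p, hp, hpa⟩ := hint
  rcases subsingleton_or_nontrivial A with h | h
  · simp [spectrum.of_subsingleton]
  refine p.rootSet_finite ℝ |>.subset fun x hx => ?_
  have h0 := spectrum.subset_polynomial_aeval a p ⟨x, hx, rfl⟩
  rw [Polynomial.aeval_def, hpa, spectrum.zero_eq] at h0
  rw [Polynomial.mem_rootSet]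
  exact ⟨hp.ne_zero, by simpa using h0⟩

lemma continuousOn_spectrum (f : ℝ → ℝ) (a : A) : ContinuousOn f (spectrum ℝ a) :=
  (finite_spectrum_real a).continuousOn f

variable {a : A}

lemma cfc_eq_sum_spectralProj (a : A) (f : ℝ → ℝ) :
    cfc f a = ∑ x ∈ (finite_spectrum_real a).toFinset, f x • spectralProj a x := by
  have h : ∀ x, f x • spectralProj a x = cfc (fun y : ℝ => f x * if y = x then 1 else 0) a := by
    intro x
    rw [cfc_const_mul _ _ _ (continuousOn_spectrum _ _), spectralProj]
  simp_rw [h]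
  rw [← cfc_sum _ _ _ (fun _ _ => continuousOn_spectrum _ _)]
  refine cfc_congr fun y hy => ?_
  simp [Finset.sum_apply, hy]

omit [FiniteDimensional ℂ A] in
lemma isSelfAdjoint_spectralProj (a : A) (x : ℝ) : IsSelfAdjoint (spectralProj a x) :=
  cfc_predicate _ a

omit [FiniteDimensional ℂ A] in
lemma isSelfAdjoint_kerProj (a : A) : IsSelfAdjoint (kerProj a) :=
  isSelfAdjoint_spectralProj a 0

lemma kerProj_mul_self (a : A) : kerProj a * kerProj a = kerProj a := by
  rw [kerProj, spectralProj, ← cfc_mul _ _ _ (continuousOn_spectrum _ _)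
    (continuousOn_spectrum _ _)]
  exact cfc_congr fun x _ => by simp

lemma mul_kerProj (ha : IsSelfAdjoint a) : a * kerProj a = 0 := by
  conv_lhs => enter [1]; rw [← cfc_id' ℝ a]
  rw [kerProj, spectralProj, ← cfc_mul _ _ _ (continuousOn_spectrum _ _)
    (continuousOn_spectrum _ _), ← cfc_zero (R := ℝ) (a := a)]
  exact cfc_congr fun x _ => by simp

lemma kerProj_mul (ha : IsSelfAdjoint a) : kerProj a * a = 0 := by
  have := congrArg star (mul_kerProj ha)
  rwa [star_mul, (isSelfAdjoint_kerProj a).star_eq, ha.star_eq, star_zero] at this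

lemma add_smul_kerProj (ha : IsSelfAdjoint a) (κ : ℝ) :
    a + κ • kerProj a = cfc (fun x : ℝ => x + κ * if x = 0 then 1 else 0) a := by
  rw [cfc_add _ _ _ (continuousOn_spectrum _ _) (continuousOn_spectrum _ _), cfc_id' ℝ a,
    cfc_const_mul _ _ _ (continuousOn_spectrum _ _), kerProj, spectralProj]

/-- Since `Real.log 0 = 0`, `CFC.log a` vanishes on the kernel of `a`, where the perturbed element
has eigenvalue `κ`. For `κ = 1` the perturbation leaves the logarithm unchanged, so a singular
logarithm becomes that of an invertible element. -/
lemma log_add_smul_kerProj (ha : IsSelfAdjoint a) (κ : ℝ) :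
    CFC.log (a + κ • kerProj a) = CFC.log a + Real.log κ • kerProj a := by
  have hc : ContinuousOn Real.log
      ((fun x : ℝ => x + κ * if x = 0 then 1 else 0) '' spectrum ℝ a) :=
    ((finite_spectrum_real a).image _).continuousOn _
  rw [add_smul_kerProj ha, CFC.log, ← cfc_comp' _ _ _ hc (continuousOn_spectrum _ _), CFC.log,
    kerProj, spectralProj, ← cfc_const_mul _ _ _ (continuousOn_spectrum _ _),
    ← cfc_add _ _ _ (continuousOn_spectrum _ _) (continuousOn_spectrum _ _)]
  refine cfc_congr fun x _ => ?_
  by_cases hx : x = 0 <;> simp [hx]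

lemma log_add_kerProj (ha : IsSelfAdjoint a) : CFC.log (a + kerProj a) = CFC.log a := by
  simpa using log_add_smul_kerProj ha 1

variable [PartialOrder A] [StarOrderedRing A]

omit [FiniteDimensional ℂ A] in
lemma spectralProj_nonneg (a : A) (x : ℝ) : 0 ≤ spectralProj a x :=
  cfc_nonneg fun y _ => by split_ifs <;> simp

omit [FiniteDimensional ℂ A] in
lemma kerProj_nonneg (a : A) : 0 ≤ kerProj a := spectralProj_nonneg a 0

lemma kerProj_le_one (a : A) : kerProj a ≤ 1 := by
  by_cases ha : IsSelfAdjoint a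
  · rw [← cfc_const_one ℝ a]
    exact cfc_mono (fun x _ => by split_ifs <;> simp) (continuousOn_spectrum _ _)
      (continuousOn_spectrum _ _)
  · rw [kerProj, spectralProj, cfc_apply_of_not_predicate a ha]
    exact zero_le_one' A

lemma isStrictlyPositive_add_smul_kerProj (ha : 0 ≤ a) {κ : ℝ} (hκ : 0 < κ) :
    IsStrictlyPositive (a + κ • kerProj a) := by
  refine ⟨add_nonneg ha (smul_nonneg hκ.le (kerProj_nonneg a)), ?_⟩
  rw [add_smul_kerProj ha.isSelfAdjoint, isUnit_cfc_iff _ _ (continuousOn_spectrum _ _)]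
  intro x _
  by_cases h0 : x = 0
  · simp [h0, hκ.ne']
  · simp [h0]

lemma isStrictlyPositive_add_kerProj (ha : 0 ≤ a) : IsStrictlyPositive (a + kerProj a) := by
  simpa using isStrictlyPositive_add_smul_kerProj ha one_pos

/-- Eigenvalues in `[0, 1]` with `0` replaced by `1` lie in `(0, 1]`; the spectrum being finite, the
bound is strict. This places every state, so corrected, in the domain of `logSeries`. -/
lemma norm_one_sub_add_kerProj_lt (ha : 0 ≤ a) (h1 : a ≤ 1) : ‖1 - (a + kerProj a)‖ < 1 := by
  have hs : IsSelfAdjoint a := ha.isSelfAdjoint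
  have h2 := add_smul_kerProj hs 1
  rw [one_smul] at h2
  rw [h2, ← cfc_const_one ℝ a, ← cfc_sub _ _ _ (continuousOn_spectrum _ _)
    (continuousOn_spectrum _ _), norm_cfc_lt_iff _ _ one_pos (continuousOn_spectrum _ _)]
  intro x hx
  have hx0 : 0 ≤ x := spectrum_nonneg_of_nonneg ha hx
  have hx1 : x ≤ 1 := by
    rw [← cfc_id' ℝ a, ← cfc_const_one ℝ a, cfc_le_iff _ _ _ (continuousOn_spectrum _ _)
      (continuousOn_spectrum _ _)] at h1
    exact h1 x hx
  by_cases h0 : x = 0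
  · simp [h0]
  · have : 0 < x := lt_of_le_of_ne hx0 (Ne.symm h0)
    rw [if_neg h0, Real.norm_eq_abs, abs_lt]
    constructor <;> linarith

omit [FiniteDimensional ℂ A] in
-- The conjugate is `star x * x` for `x = CFC.sqrt s * n`.
lemma mul_eq_zero_of_conj_eq_zero {s n : A} (hs : 0 ≤ s) (h : star n * s * n = 0) :
    s * n = 0 := by
  have h1 : star (CFC.sqrt s * n) * (CFC.sqrt s * n) = 0 := by
    rw [star_mul, (CFC.sqrt_nonneg s).isSelfAdjoint.star_eq, ← h, ← mul_assoc,
      mul_assoc (star n), CFC.sqrt_mul_sqrt_self s hs]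
  rw [CStarRing.star_mul_self_eq_zero_iff] at h1
  rw [← CFC.sqrt_mul_sqrt_self s hs, mul_assoc, h1, mul_zero]

omit [FiniteDimensional ℂ A] in
lemma mul_eq_zero_of_le {s b n : A} (hs : 0 ≤ s) (hsb : s ≤ b) (h : b * n = 0) : s * n = 0 := by
  refine mul_eq_zero_of_conj_eq_zero hs (le_antisymm ?_ (star_left_conjugate_nonneg hs n))
  simpa [mul_assoc, h] using star_left_conjugate_le_conjugate hsb n

/-- `C` bounds the reciprocals of the finitely many nonzero eigenvalues. -/
lemma exists_one_sub_kerProj_le (ha : 0 ≤ a) : ∃ C : ℝ, 0 < C ∧ 1 - kerProj a ≤ C • a := by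
  have hs : IsSelfAdjoint a := ha.isSelfAdjoint
  obtain ⟨C, hC⟩ := ((finite_spectrum_real a).image (fun x => x⁻¹)).bddAbove
  refine ⟨max C 1, by positivity, ?_⟩
  rw [kerProj, spectralProj, ← cfc_const_one ℝ a, ← cfc_sub _ _ _ (continuousOn_spectrum _ _)
    (continuousOn_spectrum _ _), ← cfc_const_mul_id _ a]
  refine cfc_mono (fun x hx => ?_) (continuousOn_spectrum _ _) (continuousOn_spectrum _ _)
  have hx0 : 0 ≤ x := spectrum_nonneg_of_nonneg ha hx
  by_cases h0 : x = 0
  · simp [h0]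
  · have hxp : 0 < x := lt_of_le_of_ne hx0 (Ne.symm h0)
    have h2 : x⁻¹ ≤ max C 1 := (hC ⟨x, hx, rfl⟩).trans (le_max_left _ _)
    rw [if_neg h0, sub_zero]
    calc (1 : ℝ) = x⁻¹ * x := (inv_mul_cancel₀ h0).symm
      _ ≤ _ := by gcongr

omit [FiniteDimensional ℂ A] in
lemma le_norm_smul_one {s : A} (hs : IsSelfAdjoint s) : s ≤ ‖s‖ • (1 : A) := by
  simpa [Algebra.algebraMap_eq_smul_one] using hs.le_algebraMap_norm_self

omit [FiniteDimensional ℂ A] in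
lemma neg_norm_smul_one_le {s : A} (hs : IsSelfAdjoint s) : -(‖s‖ • (1 : A)) ≤ s := by
  have := le_norm_smul_one hs.neg
  rw [norm_neg] at this
  exact neg_le.mp this

/-- With `P = 1 - kerProj a` one has `s = P * s * P ≤ ‖s‖ • P`, and `P` is dominated by a multiple
of `a`. This turns inclusion of supports into an order relation that positive maps preserve. -/
lemma exists_le_smul_of_mul_kerProj (ha : 0 ≤ a) {s : A} (hs : IsSelfAdjoint s)
    (h : s * kerProj a = 0) : ∃ C : ℝ, 0 < C ∧ s ≤ C • a := by
  obtain ⟨C, hC0, hC⟩ := exists_one_sub_kerProj_le ha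
  have hN := isSelfAdjoint_kerProj a
  have h' : kerProj a * s = 0 := by
    have := congrArg star h
    rwa [star_mul, hN.star_eq, hs.star_eq, star_zero] at this
  refine ⟨(‖s‖ + 1) * C, by positivity, ?_⟩
  have h1 := star_left_conjugate_le_conjugate (le_norm_smul_one hs) (1 - kerProj a)
  have e1 : star (1 - kerProj a) * s * (1 - kerProj a) = s := by
    simp [hN.star_eq, sub_mul, mul_sub, h, h']
  have e2 : star (1 - kerProj a) * (‖s‖ • (1 : A)) * (1 - kerProj a) = ‖s‖ • (1 - kerProj a) := by
    simp [hN.star_eq, sub_mul, mul_sub, kerProj_mul_self]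
  rw [e1, e2] at h1
  calc s ≤ ‖s‖ • (1 - kerProj a) := h1
    _ ≤ (‖s‖ + 1) • (1 - kerProj a) := by
        refine smul_le_smul_of_nonneg_right (by linarith) (sub_nonneg.mpr (kerProj_le_one a))
    _ ≤ (‖s‖ + 1) • (C • a) := smul_le_smul_of_nonneg_left hC (by positivity)
    _ = _ := by rw [smul_smul]

lemma kerProj_eq_of_mul_eq_zero (ha : 0 ≤ a) {n : A} (hn : IsSelfAdjoint n)
    (h : a * n = 0) (hu : IsUnit (a + n)) (hnn : n * n = n) : kerProj a = n := by
  obtain ⟨C, hC0, hC⟩ := exists_one_sub_kerProj_le ha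
  have hN := isSelfAdjoint_kerProj a
  have h1 : (1 - kerProj a) * n = 0 :=
    mul_eq_zero_of_le (sub_nonneg.mpr (kerProj_le_one a)) hC (by rw [smul_mul_assoc, h, smul_zero])
  have h2 : n * kerProj a = n := by
    have := congrArg star h1
    rw [star_mul, star_sub, star_one, hN.star_eq, hn.star_eq, mul_sub, mul_one, star_zero,
      sub_eq_zero] at this
    exact this.symm
  have h3 : (a + n) * (kerProj a - n) = 0 := by
    rw [mul_sub, add_mul, add_mul, mul_kerProj ha.isSelfAdjoint, h, h2, hnn, sub_self]
  exact sub_eq_zero.mp (hu.mul_right_eq_zero.mp h3)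

/-- The lower bound makes `b + kerProj a` strictly positive, so `b` has no kernel beyond that of
`a`. -/
lemma kerProj_eq_of_le (ha : 0 ≤ a) {b : A} {c : ℝ} (hc : 0 < c) (hab : c • a ≤ b)
    (h : b * kerProj a = 0) : kerProj b = kerProj a := by
  have hb : 0 ≤ b := (smul_nonneg hc.le ha).trans hab
  refine kerProj_eq_of_mul_eq_zero hb (isSelfAdjoint_kerProj a) h ?_ (kerProj_mul_self a)
  have h1 : IsStrictlyPositive (min c 1 • (a + kerProj a)) :=
    (isStrictlyPositive_add_kerProj ha).smul (by positivity)
  refine (h1.of_le ?_).isUnit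
  rw [smul_add]
  refine add_le_add (le_trans ?_ hab) ?_
  · exact smul_le_smul_of_nonneg_right (min_le_left _ _) ha
  · simpa using smul_le_smul_of_nonneg_right (min_le_right c 1) (kerProj_nonneg a)

end KerProj

/-! ### Trace inequalities for the logarithm. -/

section Trace

variable {A : Type*} [CStarAlgebra A] [PartialOrder A] [StarOrderedRing A]

/-- Positive tracial functionals that dominate the norm on positive elements. -/
structure IsFaithfulTrace (τ : A →L[ℝ] ℝ) : Prop where
  map_mul_comm : ∀ a b, τ (a * b) = τ (b * a)
  map_nonneg : ∀ a, 0 ≤ a → 0 ≤ τ a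
  le_smul_one : ∀ a, 0 ≤ a → a ≤ τ a • 1

namespace IsFaithfulTrace

variable {τ : A →L[ℝ] ℝ} (hτ : IsFaithfulTrace τ)
include hτ

omit [StarOrderedRing A] in
lemma eq_zero {a : A} (ha : 0 ≤ a) (h : τ a = 0) : a = 0 :=
  le_antisymm (by simpa [h] using hτ.le_smul_one a ha) ha

lemma map_mul_nonneg {a b : A} (ha : 0 ≤ a) (hb : 0 ≤ b) : 0 ≤ τ (a * b) := by
  rw [← CFC.sqrt_mul_sqrt_self a ha, mul_assoc, hτ.map_mul_comm]
  have := star_left_conjugate_nonneg hb (CFC.sqrt a)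
  rw [(CFC.sqrt_nonneg a).isSelfAdjoint.star_eq] at this
  exact hτ.map_nonneg _ this

lemma map_mul_mono {s a b : A} (hs : 0 ≤ s) (hab : a ≤ b) : τ (s * a) ≤ τ (s * b) := by
  have := hτ.map_mul_nonneg hs (sub_nonneg.mpr hab)
  rw [mul_sub, map_sub] at this
  linarith

variable [FiniteDimensional ℂ A]

/-- Operator monotonicity needs strict positivity, so `g + ε • kerProj g` is compared with `x + ε •
1`. The divergent `log ε` term is killed by `hsg`, and `ε → 0` concludes. -/
lemma map_mul_log_le {g x s : A} (hg : 0 ≤ g) (hx : IsStrictlyPositive x) (hgx : g ≤ x)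
    (hs : 0 ≤ s) (hsg : s * kerProj g = 0) : τ (s * CFC.log g) ≤ τ (s * CFC.log x) := by
  have hsa : ∀ ε : ℝ, 0 ≤ ε → IsStrictlyPositive (x + ε • (1 : A)) := fun ε hε =>
    hx.add_nonneg (smul_nonneg hε zero_le_one)
  have h1 : ∀ ε : ℝ, 0 < ε → τ (s * CFC.log g) ≤ τ (s * CFC.log (x + ε • (1 : A))) := by
    intro ε hε
    have h2 : CFC.log (g + ε • kerProj g) ≤ CFC.log (x + ε • (1 : A)) :=
      CFC.log_le_log (add_le_add hgx (smul_le_smul_of_nonneg_left (kerProj_le_one g) hε.le))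
        (isStrictlyPositive_add_smul_kerProj hg hε)
    have h3 := hτ.map_mul_mono hs h2
    rwa [log_add_smul_kerProj hg.isSelfAdjoint, mul_add, mul_smul_comm, hsg, smul_zero,
      add_zero] at h3
  have hlim : Tendsto (fun ε : ℝ => τ (s * CFC.log (x + ε • (1 : A)))) (𝓝[>] 0)
      (𝓝 (τ (s * CFC.log x))) := by
    have hl : Tendsto (fun ε : ℝ => CFC.log (x + ε • (1 : A))) (𝓝[>] 0) (𝓝 (CFC.log x)) := by
      refine (CFC.continuousOn_log x ⟨hx.nonneg.isSelfAdjoint, hx.isUnit⟩).tendsto.comp ?_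
      refine tendsto_nhdsWithin_iff.mpr ⟨?_, ?_⟩
      · have : Continuous fun ε : ℝ => x + ε • (1 : A) := by fun_prop
        simpa using (this.tendsto 0).mono_left nhdsWithin_le_nhds
      · filter_upwards [self_mem_nhdsWithin] with ε hε
        have := hsa ε (le_of_lt hε)
        exact ⟨this.nonneg.isSelfAdjoint, this.isUnit⟩
    exact (τ.continuous.tendsto _).comp (hl.const_mul s)
  refine ge_of_tendsto hlim ?_
  filter_upwards [self_mem_nhdsWithin] with ε hε using h1 ε hε

/-- Klein's inequality. -/
lemma klein {g x : A} (hg : 0 ≤ g) (hx : IsStrictlyPositive x) :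
    τ (g * CFC.log x) ≤ τ (g * CFC.log g) + τ x - τ g := by
  have hgs : IsSelfAdjoint g := hg.isSelfAdjoint
  have hxs : IsSelfAdjoint x := hx.nonneg.isSelfAdjoint
  set S := (finite_spectrum_real g).toFinset
  set p := spectralProj g
  have e1 : g = ∑ y ∈ S, y • p y := by
    conv_lhs => rw [← cfc_id' ℝ g, cfc_eq_sum_spectralProj]
  have e2 : (1 : A) = ∑ y ∈ S, p y := by
    conv_lhs => rw [← cfc_const_one ℝ g, cfc_eq_sum_spectralProj]
    simp [S, p]
  have e3 : g * CFC.log g = ∑ y ∈ S, (y * Real.log y) • p y := by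
    conv_lhs => enter [1]; rw [← cfc_id' ℝ g]
    rw [CFC.log, ← cfc_mul _ _ _ (continuousOn_spectrum _ _) (continuousOn_spectrum _ _),
      cfc_eq_sum_spectralProj]
  have f1 : τ (g * CFC.log x) = ∑ y ∈ S, y * τ (p y * CFC.log x) := by
    conv_lhs => rw [e1]
    simp [Finset.sum_mul]
  have f2 : τ x = ∑ y ∈ S, τ (p y * x) := by
    conv_lhs => rw [← one_mul x, e2, Finset.sum_mul, map_sum]
  have f3 : τ g = ∑ y ∈ S, y * τ (p y) := by
    conv_lhs => rw [e1]
    simp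
  have f4 : τ (g * CFC.log g) = ∑ y ∈ S, y * Real.log y * τ (p y) := by
    rw [e3]; simp
  rw [f1, f2, f3, f4, ← Finset.sum_add_distrib, ← Finset.sum_sub_distrib]
  refine Finset.sum_le_sum fun y hy => ?_
  have hy0 : 0 ≤ y := spectrum_nonneg_of_nonneg hg (by simpa [S] using hy)
  have hp : 0 ≤ p y := spectralProj_nonneg g y
  rcases hy0.eq_or_lt with rfl | hypos
  · simpa using hτ.map_mul_nonneg hp hx.nonneg
  -- The tangent line to the concave function `log` at `y` lies above it on the spectrum of `x`.
  · have h1 : CFC.log x ≤ (Real.log y - 1) • (1 : A) + y⁻¹ • x := by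
      have : (Real.log y - 1) • (1 : A) + y⁻¹ • x =
          cfc (fun z : ℝ => (Real.log y - 1) + y⁻¹ * z) x := by
        rw [cfc_add _ _ _ (continuousOn_spectrum _ _) (continuousOn_spectrum _ _),
          cfc_const_mul_id _ x, cfc_const _ x, Algebra.algebraMap_eq_smul_one]
      rw [this, CFC.log]
      refine cfc_mono (fun z hz => ?_) (continuousOn_spectrum _ _) (continuousOn_spectrum _ _)
      have hz0 : 0 < z := lt_of_le_of_ne (spectrum_nonneg_of_nonneg hx.nonneg hz)
        (fun h => (spectrum.zero_notMem ℝ hx.isUnit) (h ▸ hz))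
      have := Real.log_le_sub_one_of_pos (show 0 < y⁻¹ * z by positivity)
      rw [Real.log_mul (by positivity) hz0.ne', Real.log_inv] at this
      linarith
    have h2 := hτ.map_mul_mono hp h1
    simp only [mul_add, mul_smul_comm, mul_one, map_add, map_smul, smul_eq_mul] at h2
    have h3 := mul_le_mul_of_nonneg_left h2 hy0
    have h4 : y * (y⁻¹ * τ (p y * x)) = τ (p y * x) := by
      rw [← mul_assoc, mul_inv_cancel₀ hypos.ne', one_mul]
    rw [mul_add, h4] at h3
    linarith

end IsFaithfulTrace

end Trace

/-! ### One-sided derivatives and second-order tangents. -/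

section Calculus

open Asymptotics

lemma hasDerivWithinAt_of_squeeze {f g h : ℝ → ℝ} {d : ℝ} (hf : HasDerivWithinAt f d (Ioi 0) 0)
    (hh : HasDerivWithinAt h d (Ioi 0) 0) (hf0 : f 0 = g 0) (hh0 : h 0 = g 0)
    (hfg : ∀ᶠ t in 𝓝[>] (0 : ℝ), f t ≤ g t) (hgh : ∀ᶠ t in 𝓝[>] (0 : ℝ), g t ≤ h t) :
    HasDerivWithinAt g d (Ioi 0) 0 := by
  rw [hasDerivWithinAt_iff_tendsto_slope' (by simp)] at *
  refine tendsto_of_tendsto_of_tendsto_of_le_of_le' hf hh ?_ ?_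
  · filter_upwards [hfg, self_mem_nhdsWithin] with t ht ht0
    rw [slope_def_field, slope_def_field, hf0]
    have : (0 : ℝ) < t - 0 := by simpa using ht0
    gcongr
  · filter_upwards [hgh, self_mem_nhdsWithin] with t ht ht0
    rw [slope_def_field, slope_def_field, hh0]
    have : (0 : ℝ) < t - 0 := by simpa using ht0
    gcongr

lemma hasDerivWithinAt_of_isBigO_sq {E : Type*} [NormedAddCommGroup E] [NormedSpace ℝ E]
    {f : ℝ → E} {d : E} (h : (fun t => f t - f 0 - t • d) =O[𝓝[>] 0] fun t : ℝ => t ^ 2) :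
    HasDerivWithinAt f d (Ioi 0) 0 := by
  rw [hasDerivWithinAt_iff_isLittleO]
  simp only [sub_zero]
  refine h.trans_isLittleO ?_
  have : (fun t : ℝ => t ^ 2) =o[𝓝 0] fun t : ℝ => t := by
    simpa using isLittleO_pow_pow (𝕜 := ℝ) (show 1 < 2 by norm_num)
  exact this.mono nhdsWithin_le_nhds

/-- Because `t ^ 2 * log t = o(t)`. For this reason `HasTangent` asks for a quadratic remainder, not
just differentiability. -/
lemma hasDerivWithinAt_log_mul {g : ℝ → ℝ} (h : g =O[𝓝[>] 0] fun t : ℝ => t ^ 2) (h0 : g 0 = 0)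
    (a b : ℝ) : HasDerivWithinAt (fun t => (a + b * Real.log t) * g t) 0 (Ioi 0) 0 := by
  rw [hasDerivWithinAt_iff_isLittleO]
  simp only [h0, mul_zero, sub_zero, smul_zero]
  have h1 : Tendsto (fun t : ℝ => (a + b * Real.log t) * t) (𝓝[>] 0) (𝓝 0) := by
    have h2 : Tendsto (fun t : ℝ => Real.log t * t) (𝓝[>] 0) (𝓝 0) := by
      simpa using tendsto_log_mul_rpow_nhdsGT_zero (r := 1) one_pos
    have h3 : Tendsto (fun t : ℝ => t) (𝓝[>] 0) (𝓝 0) := nhdsWithin_le_nhds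
    have := (h3.const_mul a).add (h2.const_mul b)
    simp only [mul_zero, add_zero] at this
    refine this.congr fun t => by ring
  have h4 := (isBigO_refl (fun t : ℝ => a + b * Real.log t) (𝓝[>] 0)).mul h
  refine h4.trans_isLittleO ?_
  have h5 : (fun t : ℝ => (a + b * Real.log t) * t) =o[𝓝[>] 0] fun _ => (1 : ℝ) :=
    (isLittleO_one_iff ℝ).mpr h1
  have h6 := h5.mul_isBigO (isBigO_refl (fun t : ℝ => t) (𝓝[>] 0))
  simpa [pow_two, mul_assoc] using h6

lemma hasDerivWithinAt_mul_sqrt : HasDerivWithinAt (fun t : ℝ => t * √t) 0 (Ioi 0) 0 := by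
  rw [hasDerivWithinAt_iff_isLittleO]
  simp only [zero_mul, sub_zero, smul_zero]
  have h5 : (fun t : ℝ => √t) =o[𝓝[>] 0] fun _ => (1 : ℝ) := by
    rw [isLittleO_one_iff]
    have := (Real.continuous_sqrt.tendsto 0).mono_left (nhdsWithin_le_nhds (s := Ioi (0 : ℝ)))
    simpa using this
  simpa using (isBigO_refl (fun t : ℝ => t) (𝓝[>] 0)).mul_isLittleO h5

/-- `γ t = γ 0 + t • b + O(t ^ 2)` as `t → 0⁺`. -/
def HasTangent {E : Type*} [NormedAddCommGroup E] [NormedSpace ℝ E] (γ : ℝ → E) (b : E) : Prop :=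
  (fun t => γ t - γ 0 - t • b) =O[𝓝[>] 0] fun t : ℝ => t ^ 2

namespace HasTangent

variable {E F : Type*} [NormedAddCommGroup E] [NormedSpace ℝ E] [NormedAddCommGroup F]
  [NormedSpace ℝ F] {γ σ : ℝ → E} {b c : E}

lemma hasDerivWithinAt (h : HasTangent γ b) : HasDerivWithinAt γ b (Ioi 0) 0 :=
  hasDerivWithinAt_of_isBigO_sq h

lemma sub (h : HasTangent γ b) (h' : HasTangent σ c) :
    HasTangent (fun t => γ t - σ t) (b - c) := by
  refine (IsBigO.sub h h').congr_left fun t => ?_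
  simp only [smul_sub]; abel

lemma const_smul (h : HasTangent γ b) (r : ℝ) : HasTangent (fun t => r • γ t) (r • b) := by
  refine (IsBigO.const_smul_left h r).congr_left fun t => ?_
  simp only [smul_sub, smul_comm t r, Pi.smul_apply]

lemma line (a b : E) : HasTangent (fun t => a + t • b) b := by
  refine (isBigO_zero _ _).congr_left fun t => ?_
  simp

lemma isBigO_clm (h : HasTangent γ b) (f : E →L[ℝ] F) (h0 : f (γ 0) = 0) (hb : f b = 0) :
    (fun t => f (γ t)) =O[𝓝[>] 0] fun t : ℝ => t ^ 2 := by
  refine ((f.isBigO_comp (fun t => γ t - γ 0 - t • b) (𝓝[>] 0)).trans h).congr_left fun t => ?_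
  simp [h0, hb]

lemma exists_bound (h : HasTangent γ b) :
    ∃ C : ℝ, 0 < C ∧ ∀ᶠ t in 𝓝[>] (0 : ℝ), ‖γ t - γ 0 - t • b‖ ≤ C * t ^ 2 := by
  obtain ⟨C, hC, h1⟩ := IsBigO.exists_pos h
  refine ⟨C, hC, ?_⟩
  filter_upwards [h1.bound] with t ht
  simpa using ht

end HasTangent

end Calculus

/-! ### Block decomposition along a kernel projection. -/

section Curves

variable {A : Type*} [CStarAlgebra A] [FiniteDimensional ℂ A] [PartialOrder A] [StarOrderedRing A]
  {γ σ : ℝ → A} {b r : A} {τ : A →L[ℝ] ℝ}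

omit [FiniteDimensional ℂ A] in
lemma HasTangent.isSelfAdjoint (h : HasTangent γ b) (h0 : IsSelfAdjoint (γ 0))
    (hpos : ∀ᶠ t in 𝓝[>] (0 : ℝ), 0 ≤ γ t) : IsSelfAdjoint b := by
  have h1 := h.hasDerivWithinAt
  rw [hasDerivWithinAt_iff_tendsto_slope' (by simp)] at h1
  have hcl : IsClosed {x : A | star x = x} := isClosed_eq continuous_star continuous_id
  refine hcl.mem_of_tendsto h1 ?_
  filter_upwards [hpos] with t ht
  have : IsSelfAdjoint ((t - 0)⁻¹ • (γ t - γ 0)) :=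
    (IsSelfAdjoint.all _).smul (ht.isSelfAdjoint.sub h0)
  change IsSelfAdjoint (slope γ 0 t)
  rwa [slope, vsub_eq_sub]

omit [PartialOrder A] [StarOrderedRing A] in
lemma one_sub_kerProj_mul_kerProj (a : A) : (1 - kerProj a) * kerProj a = 0 := by
  rw [sub_mul, one_mul, kerProj_mul_self, sub_self]

omit [PartialOrder A] [StarOrderedRing A] in
lemma kerProj_mul_one_sub_kerProj (a : A) : kerProj a * (1 - kerProj a) = 0 := by
  rw [mul_sub, mul_one, kerProj_mul_self, sub_self]

/-- The compression of `b` to the support of `a`. -/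
def compress (a b : A) : A := (1 - kerProj a) * b * (1 - kerProj a)

omit [PartialOrder A] [StarOrderedRing A] in
lemma compress_mul_kerProj (a b : A) : compress a b * kerProj a = 0 := by
  rw [compress, mul_assoc, one_sub_kerProj_mul_kerProj, mul_zero]

omit [PartialOrder A] [StarOrderedRing A] in
lemma kerProj_mul_compress (a b : A) : kerProj a * compress a b = 0 := by
  rw [compress, ← mul_assoc, ← mul_assoc, kerProj_mul_one_sub_kerProj, zero_mul, zero_mul]

lemma neg_le_compress (a : A) (hb : IsSelfAdjoint b) :
    -(‖b‖ • (1 - kerProj a)) ≤ compress a b := by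
  have hN := isSelfAdjoint_kerProj a
  have h := star_left_conjugate_le_conjugate (neg_norm_smul_one_le hb) (1 - kerProj a)
  rw [star_sub, star_one, hN.star_eq] at h
  refine le_trans (le_of_eq ?_) h
  simp [sub_mul, mul_sub, kerProj_mul_self]

omit [FiniteDimensional ℂ A] [PartialOrder A] [StarOrderedRing A] in
lemma eq_compress_add (a : A) (h : kerProj a * b * kerProj a = 0) :
    b = compress a b + (kerProj a * b * (1 - kerProj a) + (1 - kerProj a) * b * kerProj a) := by
  have : b = compress a b + (kerProj a * b * (1 - kerProj a) + (1 - kerProj a) * b * kerProj a)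
      + kerProj a * b * kerProj a := by
    rw [compress]; noncomm_ring
  rw [h, add_zero] at this
  exact this

/-- Conjugating `E ≤ ‖E‖ • 1`, with `E` the off-diagonal part, by `w ^ 3 • P + w • N` scales `E` by
`w ^ 4` and the diagonal blocks of `1` by `w ^ 6` and `w ^ 2`. With `w = t ^ (1/4)`, a term of order
`t` is dominated at cost `t ^ (3/2)` on the support and `t ^ (1/2)` on the kernel. -/
lemma offdiag_le (a : A) (hb : IsSelfAdjoint b) (w : ℝ) :
    w ^ 4 • (kerProj a * b * (1 - kerProj a) + (1 - kerProj a) * b * kerProj a) ≤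
      ‖kerProj a * b * (1 - kerProj a) + (1 - kerProj a) * b * kerProj a‖ •
        (w ^ 6 • (1 - kerProj a) + w ^ 2 • kerProj a) := by
  set N := kerProj a
  set P := 1 - N with hP
  have hN : star N = N := isSelfAdjoint_kerProj a
  have hNN : N * N = N := kerProj_mul_self a
  have hPs : star P = P := by rw [hP, star_sub, star_one, hN]
  have hPP : P * P = P := by rw [hP]; simp [sub_mul, mul_sub, hNN]
  have hPN : P * N = 0 := by rw [hP]; simp [sub_mul, hNN]
  have hNP : N * P = 0 := by rw [hP]; simp [mul_sub, hNN]
  set E := N * b * P + P * b * N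
  have hE : IsSelfAdjoint E := by
    simp only [E, IsSelfAdjoint, star_add, star_mul, hN, hPs, hb.star_eq, ← mul_assoc]
    rw [add_comm]
  have h := star_left_conjugate_le_conjugate (le_norm_smul_one hE) (w ^ 3 • P + w • N)
  have hS : star (w ^ 3 • P + w • N) = w ^ 3 • P + w • N := by
    simp [star_add, star_smul, hN, hPs]
  rw [hS] at h
  have e1 : (w ^ 3 • P + w • N) * E * (w ^ 3 • P + w • N) = w ^ 4 • E := by
    have a1 : P * E = P * b * N := by
      simp only [E, mul_add, ← mul_assoc, hPN, hPP, zero_mul, zero_add]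
    have a2 : N * E = N * b * P := by
      simp only [E, mul_add, ← mul_assoc, hNP, hNN, zero_mul, add_zero]
    rw [add_mul, smul_mul_assoc, smul_mul_assoc, a1, a2]
    simp only [add_mul, mul_add, smul_mul_assoc, mul_smul_comm, mul_assoc, hNN, hPP, hPN, hNP,
      mul_zero, smul_zero, zero_add, add_zero, smul_smul, E, smul_add]
    rw [add_comm]
    module
  have e2 : (w ^ 3 • P + w • N) * (‖E‖ • (1 : A)) * (w ^ 3 • P + w • N) =
      ‖E‖ • (w ^ 6 • P + w ^ 2 • N) := by
    simp only [add_mul, mul_add, smul_mul_assoc, mul_smul_comm, mul_one, hNN, hPP, hPN, hNP,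
      smul_zero, zero_add, add_zero, smul_smul, smul_add]
    congr 2 <;> ring
  rwa [e1, e2] at h

end Curves

/-! ### Differentiating `τ (σ log γ)` along curves whose support may grow. -/

section Curves

variable {A : Type*} [CStarAlgebra A] [FiniteDimensional ℂ A] [PartialOrder A] [StarOrderedRing A]
  {γ σ : ℝ → A} {b r : A} {τ : A →L[ℝ] ℝ}

omit [PartialOrder A] [StarOrderedRing A] in
lemma logSeries_add_kerProj {a : A} (ha : IsSelfAdjoint a) (h1 : ‖1 - (a + kerProj a)‖ < 1) :
    logSeries (a + kerProj a) = CFC.log a := by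
  rw [← log_eq_logSeries (ha.add (isSelfAdjoint_kerProj a)) h1, log_add_kerProj ha]

/-- The logarithm of `y + κ • kerProj a`, when `y` has the same support as `a`. -/
lemma log_add_smul_kerProj_of_le {a y : A} (ha : 0 ≤ a) {c : ℝ} (hc : 0 < c) (hay : c • a ≤ y)
    (hy : y * kerProj a = 0) (h1 : ‖1 - (y + kerProj a)‖ < 1) (κ : ℝ) :
    CFC.log (y + κ • kerProj a) = logSeries (y + kerProj a) + Real.log κ • kerProj a := by
  have hy0 : 0 ≤ y := (smul_nonneg hc.le ha).trans hay
  have hk := kerProj_eq_of_le ha hc hay hy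
  rw [← hk, log_add_smul_kerProj hy0.isSelfAdjoint, logSeries_add_kerProj hy0.isSelfAdjoint]
  rwa [hk]

lemma isStrictlyPositive_add_smul_kerProj_of_le {a y : A} (ha : 0 ≤ a) {c : ℝ} (hc : 0 < c)
    (hay : c • a ≤ y) (hy : y * kerProj a = 0) {κ : ℝ} (hκ : 0 < κ) :
    IsStrictlyPositive (y + κ • kerProj a) := by
  have hy0 : 0 ≤ y := (smul_nonneg hc.le ha).trans hay
  rw [← kerProj_eq_of_le ha hc hay hy]
  exact isStrictlyPositive_add_smul_kerProj hy0 hκ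

omit [FiniteDimensional ℂ A] [PartialOrder A] [StarOrderedRing A] in
/-- `t ↦ τ (σ t * log (m t))` is differentiable at `0⁺` near strictly positive `m 0`. -/
lemma hasDerivWithinAt_map_mul_logSeries {m : ℝ → A} {d : A} {s : Set ℝ} {x : ℝ}
    (hσ : HasDerivWithinAt σ r s x) (hm : HasDerivWithinAt m d s x) (h1 : ‖1 - m x‖ < 1)
    (τ : A →L[ℝ] ℝ) :
    HasDerivWithinAt (fun t => τ (σ t * logSeries (m t)))
      (τ (r * logSeries (m x)) + τ (σ x * logDeriv (m x) d)) s x := by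
  have h2 := (hasFDerivAt_logSeries h1).comp_hasDerivWithinAt x hm
  have h3 := τ.hasFDerivAt.comp_hasDerivWithinAt x (hσ.mul h2)
  simpa [map_add] using! h3

/-- The curve `γ t` is dominated by an element commuting with `N`, so its logarithm splits into a
power series on the support and a scalar logarithm on the kernel. The scalar has size `log t`, but
it multiplies `τ (σ t * N) = O(t ^ 2)`, so only the compressed velocity enters the slope. -/
lemma exists_upper_bound (hτ : IsFaithfulTrace τ) (hγ : HasTangent γ b) (hσ : HasTangent σ r)
    (h0 : 0 ≤ γ 0) (h1 : γ 0 ≤ 1) (hb : IsSelfAdjoint b)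
    (hNbN : kerProj (γ 0) * b * kerProj (γ 0) = 0)
    (hpos : ∀ᶠ t in 𝓝[>] (0 : ℝ), 0 ≤ γ t ∧ 0 ≤ σ t ∧ σ t * kerProj (γ t) = 0)
    (hσN : σ 0 * kerProj (γ 0) = 0) (hrN : τ (r * kerProj (γ 0)) = 0) :
    ∃ V : ℝ → ℝ, (∀ᶠ t in 𝓝[>] (0 : ℝ), τ (σ t * CFC.log (γ t)) ≤ V t) ∧
      V 0 = τ (σ 0 * CFC.log (γ 0)) ∧
      HasDerivWithinAt V (τ (r * CFC.log (γ 0)) +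
        τ (σ 0 * logDeriv (γ 0 + kerProj (γ 0)) (compress (γ 0) b))) (Ioi 0) 0 := by
  set N := kerProj (γ 0) with hN
  set P := 1 - N with hP
  set E := N * b * P + P * b * N with hE
  obtain ⟨C, hC0, hC⟩ := hγ.exists_bound
  obtain ⟨C₁, hC₁0, hC₁⟩ := exists_one_sub_kerProj_le h0
  have hφ : IsSelfAdjoint (γ 0) := h0.isSelfAdjoint
  have hPnn : 0 ≤ P := sub_nonneg.mpr (kerProj_le_one _)
  have hNnn : 0 ≤ N := kerProj_nonneg _
  have hPN : P * N = 0 := one_sub_kerProj_mul_kerProj _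
  -- `‖E‖` pays for the off-diagonal part of the velocity, `C` for the quadratic remainder. The
  -- corrections are `c * t * √t` on the support, with zero slope, and `c * √t` on the kernel.
  set c := ‖E‖ + C with hc
  have hc0 : 0 < c := by positivity
  have hn1 := norm_one_sub_add_kerProj_lt h0 h1
  set y : ℝ → A := fun t => γ 0 + t • compress (γ 0) b + (c * (t * √t)) • P with hy
  set m : ℝ → A := fun t => y t + N with hm
  have hm0 : m 0 = γ 0 + N := by simp [hm, hy]
  have hmd : HasDerivWithinAt m (compress (γ 0) b) (Ioi 0) 0 := by
    have h2 := ((((hasDerivWithinAt_id (0 : ℝ) (Ioi 0)).smul_const (compress (γ 0) b)).const_add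
      (γ 0)).add ((hasDerivWithinAt_mul_sqrt.const_mul c).smul_const P)).add_const N
    simp only [one_smul, mul_zero, zero_smul, add_zero] at h2
    exact h2
  have hlog0 : logSeries (m 0) = CFC.log (γ 0) := by
    rw [hm0]; exact logSeries_add_kerProj hφ hn1
  have hmev : ∀ᶠ t in 𝓝[>] (0 : ℝ), ‖1 - m t‖ < 1 := by
    have : Tendsto (fun t => ‖1 - m t‖) (𝓝[>] 0) (𝓝 ‖1 - m 0‖) :=
      ((hmd.continuousWithinAt.tendsto).const_sub 1).norm
    exact this.eventually_lt_const (by rwa [hm0])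
  have hσNO : (fun t => τ (σ t * N)) =O[𝓝[>] 0] fun t : ℝ => t ^ 2 := by
    have := hσ.isBigO_clm (τ.comp ((ContinuousLinearMap.mul ℝ A).flip N)) (by simp [hσN])
      (by simpa using hrN)
    simpa using this
  refine ⟨fun t => τ (σ t * logSeries (m t)) +
    (Real.log c + 1 / 2 * Real.log t) * τ (σ t * N), ?_, ?_, ?_⟩
  · have hsmall : ∀ᶠ t in 𝓝[>] (0 : ℝ), t < min 1 (1 / (2 * ((‖b‖ + 1) * C₁))) :=
      (nhdsWithin_le_nhds (s := Ioi (0 : ℝ))) (eventually_lt_nhds (by positivity))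
    filter_upwards [hpos, hC, hmev, hsmall, self_mem_nhdsWithin] with t htp htC htm hts ht0
    have ht0 : 0 < t := ht0
    have ht1 : t < 1 := hts.trans_le (min_le_left _ _)
    have ht2 : t * ((‖b‖ + 1) * C₁) ≤ 1 / 2 := by
      have := hts.trans_le (min_le_right _ _)
      rw [lt_div_iff₀ (by positivity)] at this
      linarith
    have hyN : y t * N = 0 := by
      simp only [hy, add_mul, smul_mul_assoc, hPN, smul_zero, add_zero]
      rw [hN, mul_kerProj hφ, compress_mul_kerProj, smul_zero, add_zero]
    have hyle : (1 / 2 : ℝ) • γ 0 ≤ y t := by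
      have a1 : -((t * ‖b‖) • P) ≤ t • compress (γ 0) b := by
        have := smul_le_smul_of_nonneg_left (neg_le_compress (γ 0) hb) ht0.le
        rwa [smul_neg, smul_smul] at this
      have a2 : (t * ‖b‖) • P ≤ (1 / 2 : ℝ) • γ 0 := by
        calc (t * ‖b‖) • P ≤ (t * ‖b‖) • (C₁ • γ 0) :=
              smul_le_smul_of_nonneg_left hC₁ (by positivity)
          _ = (t * (‖b‖ * C₁)) • γ 0 := by rw [smul_smul]; ring_nf
          _ ≤ _ := by
              refine smul_le_smul_of_nonneg_right ?_ h0
              refine le_trans ?_ ht2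
              gcongr
              linarith
      have a3 : 0 ≤ (c * (t * √t)) • P := smul_nonneg (by positivity) hPnn
      calc (1 / 2 : ℝ) • γ 0 = γ 0 + -((1 / 2 : ℝ) • γ 0) + 0 := by module
        _ ≤ γ 0 + t • compress (γ 0) b + (c * (t * √t)) • P := by
            gcongr
            exact (neg_le_neg a2).trans a1
    have hκ : 0 < c * √t := by positivity
    have hγle : γ t ≤ y t + (c * √t) • N := by
      set w := √(√t) with hw
      have hw2 : w ^ 2 = √t := Real.sq_sqrt (Real.sqrt_nonneg t)
      have hw4 : w ^ 4 = t := by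
        rw [show w ^ 4 = (w ^ 2) ^ 2 by ring, hw2, Real.sq_sqrt ht0.le]
      have hw6 : w ^ 6 = t * √t := by
        rw [show w ^ 6 = w ^ 4 * w ^ 2 by ring, hw2, hw4]
      have h2 := offdiag_le (γ 0) hb w
      rw [hw4, hw6, hw2] at h2
      change t • E ≤ ‖E‖ • ((t * √t) • P + √t • N) at h2
      set ρ := γ t - γ 0 - t • b with hρ
      have hρs : IsSelfAdjoint ρ :=
        (htp.1.isSelfAdjoint.sub hφ).sub ((IsSelfAdjoint.all t).smul hb)
      have h3 : ρ ≤ C • ((t * √t) • P + √t • N) := by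
        have hs1 : √t ≤ 1 := Real.sqrt_le_one.mpr ht1.le
        have b1 : t ^ 2 ≤ t * √t := by
          rw [pow_two]
          gcongr
          exact Real.le_sqrt_of_sq_le (by nlinarith)
        have b2 : t ^ 2 ≤ √t := b1.trans (by nlinarith [Real.sqrt_nonneg t])
        calc ρ ≤ ‖ρ‖ • (1 : A) := le_norm_smul_one hρs
          _ ≤ (C * t ^ 2) • (1 : A) := smul_le_smul_of_nonneg_right htC zero_le_one
          _ = C • (t ^ 2 • P + t ^ 2 • N) := by rw [hP]; module
          _ ≤ _ := by
              refine smul_le_smul_of_nonneg_left (add_le_add ?_ ?_) hC0.le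
              · exact smul_le_smul_of_nonneg_right b1 hPnn
              · exact smul_le_smul_of_nonneg_right b2 hNnn
      have h4 : b = compress (γ 0) b + E := eq_compress_add (γ 0) hNbN
      calc γ t = γ 0 + t • b + ρ := by rw [hρ]; abel
        _ = γ 0 + t • compress (γ 0) b + (t • E + ρ) := by
            conv_lhs => rw [h4]
            module
        _ ≤ γ 0 + t • compress (γ 0) b + (‖E‖ • ((t * √t) • P + √t • N) +
              C • ((t * √t) • P + √t • N)) := by gcongr
        _ = _ := by simp only [hy, hc]; module
    have h5 := hτ.map_mul_log_le htp.1
      (isStrictlyPositive_add_smul_kerProj_of_le h0 (by norm_num) hyle hyN hκ) hγle htp.2.1 htp.2.2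
    rw [log_add_smul_kerProj_of_le h0 (by norm_num) hyle hyN htm, mul_add, map_add,
      mul_smul_comm, map_smul, smul_eq_mul, Real.log_mul hc0.ne' (by positivity),
      Real.log_sqrt ht0.le] at h5
    refine h5.trans (le_of_eq ?_)
    simp only [hm]
    ring
  · simp only [hσN, map_zero, mul_zero, add_zero, hlog0]
  · have h2 := (hasDerivWithinAt_map_mul_logSeries hσ.hasDerivWithinAt hmd (by rwa [hm0]) τ).add
      (hasDerivWithinAt_log_mul hσNO (by simp [hσN]) (Real.log c) (1 / 2))
    rw [add_zero, hlog0, hm0] at h2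
    exact h2

omit [FiniteDimensional ℂ A] in
-- Differentiate `log ((1 + s) • a) = log (1 + s) • 1 + log a` at `s = 0`.
lemma logDeriv_self {a : A} (ha : IsStrictlyPositive a) (h1 : ‖1 - a‖ < 1) :
    logDeriv a a = 1 := by
  have h2 := hasDerivAt_logSeries_line h1 a
  have h3 : HasDerivAt (fun s : ℝ => Real.log (1 + s) • (1 : A) + logSeries a) (1 : A) 0 := by
    have := ((((hasDerivAt_id (0 : ℝ)).const_add 1).log (by simp)).smul_const (1 : A)).add_const
      (logSeries a)
    simpa using! this
  refine h2.unique (h3.congr_of_eventuallyEq ?_)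
  have hev : ∀ᶠ s in 𝓝 (0 : ℝ), ‖1 - (a + s • a)‖ < 1 := by
    have : Continuous fun s : ℝ => ‖1 - (a + s • a)‖ := by fun_prop
    exact this.continuousAt.eventually_lt_const (by simpa using h1)
  filter_upwards [hev, eventually_gt_nhds (show (-1 : ℝ) < 0 by norm_num)] with s hs hs1
  have hs2 : 0 < 1 + s := by linarith
  have e : a + s • a = (1 + s) • a := by module
  have hsa : IsSelfAdjoint a := ha.nonneg.isSelfAdjoint
  rw [← log_eq_logSeries (hsa.add ((IsSelfAdjoint.all s).smul hsa)) hs, e,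
    CFC.log_smul' a hs2 ha, log_eq_logSeries hsa h1, Algebra.algebraMap_eq_smul_one]

omit [PartialOrder A] [StarOrderedRing A] in
lemma commute_kerProj_add {a : A} (ha : IsSelfAdjoint a) :
    Commute (kerProj a) (a + kerProj a) := by
  rw [Commute, SemiconjBy, mul_add, add_mul, mul_kerProj ha, kerProj_mul ha]

/-- By trace symmetry the derivative may fall on `a + kerProj a` in its own direction, where it is
`1`; the added `kerProj a` contributes nothing against a compression. -/
lemma map_mul_logDeriv_compress (hτ : IsFaithfulTrace τ) {a : A} (ha : 0 ≤ a) (h1 : a ≤ 1) (b : A) :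
    τ (a * logDeriv (a + kerProj a) (compress a b)) = τ (compress a b) := by
  have hn := norm_one_sub_add_kerProj_lt ha h1
  have h2 : kerProj a * logDeriv (a + kerProj a) (compress a b) = 0 := by
    rw [mul_logDeriv hn (commute_kerProj_add ha.isSelfAdjoint), kerProj_mul_compress, map_zero]
  have h3 := trace_mul_logDeriv hn τ hτ.map_mul_comm (compress a b) (a + kerProj a)
  rw [logDeriv_self (isStrictlyPositive_add_kerProj ha) hn, mul_one, add_mul, h2, add_zero] at h3
  exact h3.symm

omit [StarOrderedRing A] in
lemma map_mul_kerProj (hτ : IsFaithfulTrace τ) (a b : A) :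
    τ (b * kerProj a) = τ (kerProj a * b * kerProj a) := by
  rw [hτ.map_mul_comm (kerProj a * b), ← mul_assoc, kerProj_mul_self, hτ.map_mul_comm]

omit [StarOrderedRing A] in
lemma map_compress (hτ : IsFaithfulTrace τ) (a b : A) :
    τ (compress a b) = τ b - τ (kerProj a * b * kerProj a) := by
  have hk := kerProj_mul_self a
  rw [compress, hτ.map_mul_comm, ← mul_assoc]
  simp only [sub_mul, mul_sub, one_mul, mul_one, hk, map_sub]
  rw [hτ.map_mul_comm (kerProj a) b, map_mul_kerProj hτ]
  ring

/-- The right derivative of `τ (γ log γ)` along a curve of positive elements which leaves the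
support of `γ 0` only to second order. -/
theorem hasDerivWithinAt_map_mul_log_self (hτ : IsFaithfulTrace τ) (hγ : HasTangent γ b)
    (h0 : 0 ≤ γ 0) (h1 : γ 0 ≤ 1) (hNbN : kerProj (γ 0) * b * kerProj (γ 0) = 0)
    (hb : τ b = 0) (hpos : ∀ᶠ t in 𝓝[>] (0 : ℝ), 0 ≤ γ t) :
    HasDerivWithinAt (fun t => τ (γ t * CFC.log (γ t))) (τ (b * CFC.log (γ 0))) (Ioi 0) 0 := by
  have hφ : IsSelfAdjoint (γ 0) := h0.isSelfAdjoint
  have hbs : IsSelfAdjoint b := hγ.isSelfAdjoint hφ hpos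
  set N := kerProj (γ 0) with hN
  have hγN : γ 0 * N = 0 := mul_kerProj hφ
  have hbN : τ (b * N) = 0 := by rw [hN, map_mul_kerProj hτ, hNbN, map_zero]
  obtain ⟨V, hV, hV0, hVd⟩ := exists_upper_bound hτ hγ hγ h0 h1 hbs hNbN
    (by filter_upwards [hpos] with t ht using ⟨ht, ht, mul_kerProj ht.isSelfAdjoint⟩) hγN hbN
  rw [map_mul_logDeriv_compress hτ h0 h1, map_compress hτ, ← hN, hNbN, hb, map_zero, sub_zero,
    add_zero] at hVd
  have hO : (fun t => τ (γ t * N)) =O[𝓝[>] 0] fun t : ℝ => t ^ 2 := by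
    have := hγ.isBigO_clm (τ.comp ((ContinuousLinearMap.mul ℝ A).flip N)) (by simp [hγN])
      (by simpa using hbN)
    simpa using this
  -- The lower bound is Klein's inequality against `γ 0 + t ^ 2 • N`. The weight `t ^ 2` has trace
  -- `o(t)`, and its logarithm `2 * log t` multiplies a quantity of order `t ^ 2`.
  have hW : HasDerivWithinAt (fun t => τ (γ t * CFC.log (γ 0)) +
      (0 + 2 * Real.log t) * τ (γ t * N) + τ (γ t) - t ^ 2 * τ N) (τ (b * CFC.log (γ 0)))
      (Ioi 0) 0 := by
    have d1 := τ.hasFDerivAt.comp_hasDerivWithinAt 0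
      (hγ.hasDerivWithinAt.mul_const (CFC.log (γ 0)))
    have d2 := τ.hasFDerivAt.comp_hasDerivWithinAt 0 hγ.hasDerivWithinAt
    have d3 := ((hasDerivWithinAt_id (0 : ℝ) (Ioi 0)).pow 2).mul_const (τ N)
    have d4 := ((d1.add (hasDerivWithinAt_log_mul hO (by simp [hγN]) 0 2)).add d2).sub d3
    rw [hb] at d4
    simpa using! d4
  have hW' := hW.sub_const (τ (γ 0))
  refine hasDerivWithinAt_of_squeeze hW' hVd ?_ hV0 ?_ hV
  · simp [hγN]
  · filter_upwards [hpos, self_mem_nhdsWithin] with t ht ht0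
    have ht0 : 0 < t := ht0
    have hk := hτ.klein ht (isStrictlyPositive_add_smul_kerProj h0 (show 0 < t ^ 2 by positivity))
    rw [log_add_smul_kerProj hφ, mul_add, map_add, mul_smul_comm, map_smul, smul_eq_mul, map_add,
      map_smul, smul_eq_mul, Real.log_pow] at hk
    push_cast at hk
    simp only [hN]
    linarith

/-- The right derivative of `τ (σ log γ)` along curves of positive elements with `σ ≤ C γ`. -/
theorem hasDerivWithinAt_map_mul_log (hτ : IsFaithfulTrace τ) (hγ : HasTangent γ b)
    (hσ : HasTangent σ r) (h0 : 0 ≤ γ 0) (h1 : γ 0 ≤ 1)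
    (hNbN : kerProj (γ 0) * b * kerProj (γ 0) = 0) (hb : τ b = 0) {C : ℝ}
    (hpos : ∀ᶠ t in 𝓝[>] (0 : ℝ), 0 ≤ γ t ∧ 0 ≤ σ t ∧ σ t ≤ C • γ t)
    (hσN : σ 0 * kerProj (γ 0) = 0) (hrN : τ (r * kerProj (γ 0)) = 0) :
    HasDerivWithinAt (fun t => τ (σ t * CFC.log (γ t)))
      (τ (r * CFC.log (γ 0)) +
        τ (σ 0 * logDeriv (γ 0 + kerProj (γ 0)) (compress (γ 0) b))) (Ioi 0) 0 := by
  have hφ : IsSelfAdjoint (γ 0) := h0.isSelfAdjoint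
  have hbs : IsSelfAdjoint b := hγ.isSelfAdjoint hφ (hpos.mono fun t ht => ht.1)
  have hγN : γ 0 * kerProj (γ 0) = 0 := mul_kerProj hφ
  have hbN : τ (b * kerProj (γ 0)) = 0 := by rw [map_mul_kerProj hτ, hNbN, map_zero]
  have hle : ∀ {t : ℝ}, 0 ≤ γ t → ∀ {s : A}, 0 ≤ s → s ≤ C • γ t → s * kerProj (γ t) = 0 :=
    fun ht _ hs hs' => mul_eq_zero_of_le hs hs'
      (by rw [smul_mul_assoc, mul_kerProj ht.isSelfAdjoint, smul_zero])
  obtain ⟨V, hV, hV0, hVd⟩ := exists_upper_bound hτ hγ hσ h0 h1 hbs hNbN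
    (by filter_upwards [hpos] with t ht using ⟨ht.1, ht.2.1, hle ht.1 ht.2.1 ht.2.2⟩) hσN hrN
  -- An upper bound for `C • γ - σ`, subtracted from `C * τ (γ log γ)`, is a lower bound for `τ (σ
  -- log γ)`.
  obtain ⟨W, hW, hW0, hWd⟩ := exists_upper_bound hτ hγ ((hγ.const_smul C).sub hσ) h0 h1 hbs hNbN
    (by
      filter_upwards [hpos] with t ht
      refine ⟨ht.1, sub_nonneg.mpr ht.2.2, ?_⟩
      rw [sub_mul, hle ht.1 ht.2.1 ht.2.2, smul_mul_assoc, mul_kerProj ht.1.isSelfAdjoint,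
        smul_zero, sub_zero])
    (by rw [sub_mul, hσN, smul_mul_assoc, hγN, smul_zero, sub_zero])
    (by rw [sub_mul, map_sub, hrN, smul_mul_assoc, map_smul, hbN, smul_zero, sub_zero])
  have hself := hasDerivWithinAt_map_mul_log_self hτ hγ h0 h1 hNbN hb
    (hpos.mono fun t ht => ht.1)
  have hlow := (hself.const_mul C).sub hWd
  have e : τ (compress (γ 0) b) = 0 := by rw [map_compress hτ, hNbN, hb, map_zero, sub_zero]
  have hlow' : HasDerivWithinAt (fun t => C * τ (γ t * CFC.log (γ t)) - W t)
      (τ (r * CFC.log (γ 0)) +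
        τ (σ 0 * logDeriv (γ 0 + kerProj (γ 0)) (compress (γ 0) b))) (Ioi 0) 0 := by
    refine hlow.congr_deriv ?_
    simp only [sub_mul, map_sub, smul_mul_assoc, map_smul, smul_eq_mul,
      map_mul_logDeriv_compress hτ h0 h1, e]
    ring
  refine hasDerivWithinAt_of_squeeze hlow' hVd ?_ hV0 ?_ hV
  · rw [hW0, sub_mul, map_sub, smul_mul_assoc, map_smul, smul_eq_mul, sub_sub_cancel]
  · filter_upwards [hW] with t ht
    rw [sub_mul, map_sub, smul_mul_assoc, map_smul, smul_eq_mul] at ht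
    linarith

/-- If a curve of positive elements leaves the support of `γ 0` to first order, its entropy has
infinite slope. -/
theorem tendsto_slope_map_mul_log_atTop (hτ : IsFaithfulTrace τ) (hγ : HasTangent γ b)
    (h0 : 0 ≤ γ 0) (h1 : γ 0 ≤ 1) (hb : 0 < τ (b * kerProj (γ 0)))
    (hpos : ∀ᶠ t in 𝓝[>] (0 : ℝ), 0 ≤ γ t) :
    Tendsto (fun t => (τ (γ 0 * CFC.log (γ 0)) - τ (γ t * CFC.log (γ t))) / t) (𝓝[>] 0) atTop := by
  have hφ : IsSelfAdjoint (γ 0) := h0.isSelfAdjoint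
  set N := kerProj (γ 0) with hN
  set P := 1 - N with hP
  have hPnn : 0 ≤ P := sub_nonneg.mpr (kerProj_le_one _)
  have hγN : γ 0 * N = 0 := mul_kerProj hφ
  obtain ⟨C, hC0, hC⟩ := hγ.exists_bound
  set c := ‖b‖ + C
  have hc0 : 0 < c := by positivity
  have hn1 := norm_one_sub_add_kerProj_lt h0 h1
  -- A crude bound suffices here: `γ t ≤ γ 0 + (c * t) • 1`, split over support and kernel.
  set y : ℝ → A := fun t => γ 0 + (c * t) • P with hy
  set m : ℝ → A := fun t => y t + N with hm
  have hm0 : m 0 = γ 0 + N := by simp [hm, hy]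
  have hmd : HasDerivWithinAt m (c • P) (Ioi 0) 0 := by
    have h2 := ((((hasDerivWithinAt_id (0 : ℝ) (Ioi 0)).const_mul c).smul_const P).const_add
      (γ 0)).add_const N
    rw [mul_one] at h2
    exact h2
  have hlog0 : logSeries (m 0) = CFC.log (γ 0) := by
    rw [hm0]; exact logSeries_add_kerProj hφ hn1
  have hmev : ∀ᶠ t in 𝓝[>] (0 : ℝ), ‖1 - m t‖ < 1 := by
    have : Tendsto (fun t => ‖1 - m t‖) (𝓝[>] 0) (𝓝 ‖1 - m 0‖) :=
      ((hmd.continuousWithinAt.tendsto).const_sub 1).norm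
    exact this.eventually_lt_const (by rwa [hm0])
  have hd := hasDerivWithinAt_map_mul_logSeries hγ.hasDerivWithinAt hmd (by rwa [hm0]) τ
  have hd' := τ.hasFDerivAt.comp_hasDerivWithinAt 0 (hγ.hasDerivWithinAt.mul_const N)
  rw [hasDerivWithinAt_iff_tendsto_slope' (by simp)] at hd hd'
  have hlogc : Tendsto (fun t : ℝ => -Real.log (c * t)) (𝓝[>] 0) atTop := by
    refine tendsto_neg_atBot_atTop.comp (Real.tendsto_log_nhdsGT_zero.comp ?_)
    refine tendsto_nhdsWithin_iff.mpr ⟨?_, ?_⟩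
    · have : Continuous fun t : ℝ => c * t := by fun_prop
      simpa using (this.tendsto 0).mono_left (nhdsWithin_le_nhds (s := Ioi (0 : ℝ)))
    · filter_upwards [self_mem_nhdsWithin] with t ht
      exact mul_pos hc0 ht
  -- The kernel weight divided by `t` tends to `τ (b * N) > 0`, so multiplied by `-log (c * t)` it
  -- diverges; the support part has a finite slope.
  have hlim := (hlogc.atTop_mul_pos hb hd').atTop_add hd.neg
  refine tendsto_atTop_mono' _ ?_ hlim
  have hsmall : ∀ᶠ t in 𝓝[>] (0 : ℝ), t < 1 :=
    (nhdsWithin_le_nhds (s := Ioi (0 : ℝ))) (eventually_lt_nhds one_pos)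
  filter_upwards [hpos, hC, hmev, hsmall, self_mem_nhdsWithin] with t htp htC htm ht1 ht0
  have ht0 : 0 < t := ht0
  have hyN : y t * N = 0 := by
    simp only [hy, add_mul, smul_mul_assoc, hP, hN, one_sub_kerProj_mul_kerProj, smul_zero,
      add_zero]
    exact hγN
  have hyle : (1 : ℝ) • γ 0 ≤ y t := by
    rw [one_smul]
    exact le_add_of_nonneg_right (smul_nonneg (by positivity) hPnn)
  have hγle : γ t ≤ y t + (c * t) • N := by
    have hs : IsSelfAdjoint (γ t - γ 0) := htp.isSelfAdjoint.sub hφ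
    have hnorm : ‖γ t - γ 0‖ ≤ c * t := by
      calc ‖γ t - γ 0‖ = ‖(γ t - γ 0 - t • b) + t • b‖ := by rw [sub_add_cancel]
        _ ≤ C * t ^ 2 + t * ‖b‖ := by
            refine (norm_add_le _ _).trans (add_le_add htC ?_)
            rw [norm_smul, Real.norm_of_nonneg ht0.le]
        _ ≤ C * t + t * ‖b‖ := by
            gcongr
            nlinarith
        _ = c * t := by ring
    calc γ t = γ 0 + (γ t - γ 0) := by abel
      _ ≤ γ 0 + ‖γ t - γ 0‖ • (1 : A) := by gcongr; exact le_norm_smul_one hs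
      _ ≤ γ 0 + (c * t) • (1 : A) := by
          gcongr
      _ = _ := by simp only [hy, hP]; module
  have h5 := hτ.map_mul_log_le htp
    (isStrictlyPositive_add_smul_kerProj_of_le h0 one_pos hyle hyN (show 0 < c * t by positivity))
    hγle htp (mul_kerProj htp.isSelfAdjoint)
  rw [log_add_smul_kerProj_of_le h0 one_pos hyle hyN htm, mul_add, map_add,
    mul_smul_comm, map_smul, smul_eq_mul] at h5
  simp only [slope_def_field, Function.comp_apply, hγN, map_zero, sub_zero, hlog0]
  rw [mul_div_assoc', ← neg_div, ← add_div]
  gcongr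
  simp only [hm] at *
  linarith

end Curves

/-! ### Operator semigroups and invariant cones. -/

section Flow

variable {E : Type*} [NormedAddCommGroup E] [NormedSpace ℂ E]

/-- The semigroup generated by `𝓛`. -/
def flow (𝓛 : E →L[ℂ] E) (t : ℝ) (a : E) : E := NormedSpace.exp ((t : ℂ) • 𝓛) a

lemma flow_zero (𝓛 : E →L[ℂ] E) (a : E) : flow 𝓛 0 a = a := by
  simp [flow]

lemma flow_map_add (𝓛 : E →L[ℂ] E) (t : ℝ) (a b : E) :
    flow 𝓛 t (a + b) = flow 𝓛 t a + flow 𝓛 t b := map_add _ _ _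

lemma flow_map_sub (𝓛 : E →L[ℂ] E) (t : ℝ) (a b : E) :
    flow 𝓛 t (a - b) = flow 𝓛 t a - flow 𝓛 t b := map_sub _ _ _

lemma map_real_smul (f : E →L[ℂ] E) (c : ℝ) (a : E) : f (c • a) = c • f a := by
  rw [← Complex.coe_smul, map_smul, Complex.coe_smul]

lemma flow_map_smul (𝓛 : E →L[ℂ] E) (t c : ℝ) (a : E) :
    flow 𝓛 t (c • a) = c • flow 𝓛 t a := map_real_smul _ _ _

variable [CompleteSpace E]

lemma exp_add_of_commute_clm (𝓛 : E →L[ℂ] E) {Φ : E →L[ℂ] E} (h : Commute 𝓛 Φ) :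
    NormedSpace.exp (𝓛 + Φ) = NormedSpace.exp 𝓛 * NormedSpace.exp Φ := by
  let _ : NormedAlgebra ℚ (E →L[ℂ] E) := NormedAlgebra.restrictScalars ℚ ℂ _
  exact NormedSpace.exp_add_of_commute h

lemma flow_add (𝓛 : E →L[ℂ] E) (s t : ℝ) (a : E) : flow 𝓛 (s + t) a = flow 𝓛 s (flow 𝓛 t a) := by
  have h : Commute ((s : ℂ) • 𝓛) ((t : ℂ) • 𝓛) :=
    ((Commute.refl 𝓛).smul_left _).smul_right _
  rw [flow, Complex.ofReal_add, add_smul, exp_add_of_commute_clm _ h]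
  rfl

lemma hasDerivAt_flow (𝓛 : E →L[ℂ] E) (a : E) (t : ℝ) :
    HasDerivAt (fun t => flow 𝓛 t a) (𝓛 (flow 𝓛 t a)) t := by
  have h := (hasDerivAt_exp_smul_const' (𝕂 := ℂ) 𝓛 (t : ℂ)).clm_apply
    (hasDerivAt_const (t : ℂ) a)
  have h2 := h.scomp t (Complex.ofRealCLM.hasDerivAt (x := t))
  simpa using! h2

lemma continuous_flow (𝓛 : E →L[ℂ] E) (a : E) : Continuous fun t => flow 𝓛 t a :=
  continuous_iff_continuousAt.mpr fun t => (hasDerivAt_flow 𝓛 a t).continuousAt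

lemma hasTangent_flow (𝓛 : E →L[ℂ] E) (a : E) : HasTangent (fun t => flow 𝓛 t a) (𝓛 a) := by
  have h1 := (NormedSpace.exp_hasFPowerSeriesAt_zero (𝕂 := ℂ)
    (𝔸 := E →L[ℂ] E)).isBigO_sub_partialSum_pow 2
  have h2 : Tendsto (fun t : ℝ => (t : ℂ) • 𝓛) (𝓝[>] 0) (𝓝 0) := by
    have : Continuous fun t : ℝ => (t : ℂ) • 𝓛 := by fun_prop
    simpa using (this.tendsto 0).mono_left (nhdsWithin_le_nhds (s := Ioi (0 : ℝ)))
  have h3 := h1.comp_tendsto h2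
  have h4 := (ContinuousLinearMap.apply ℂ E a).isBigO_comp
    (fun t : ℝ => NormedSpace.exp ((t : ℂ) • 𝓛) - 1 - (t : ℂ) • 𝓛) (𝓝[>] 0)
  have h5 : (fun t : ℝ => NormedSpace.exp ((t : ℂ) • 𝓛) - 1 - (t : ℂ) • 𝓛) =O[𝓝[>] 0]
      fun t : ℝ => t ^ 2 := by
    refine (h3.congr_left fun t => ?_).trans ?_
    · simp [FormalMultilinearSeries.partialSum, Finset.sum_range_succ,
        NormedSpace.expSeries_apply_eq, sub_sub]
    · refine Asymptotics.IsBigO.of_bound (‖𝓛‖ ^ 2) (.of_forall fun t => ?_)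
      simp [norm_smul, mul_pow, mul_comm]
  refine (h4.trans h5).congr_left fun t => ?_
  simp [flow, Complex.coe_smul]

lemma hasSum_flow (𝓛 : E →L[ℂ] E) (t : ℝ) (a : E) :
    HasSum (fun n : ℕ => ((n.factorial : ℝ)⁻¹ * t ^ n) • (𝓛 ^ n) a) (flow 𝓛 t a) := by
  have h := (NormedSpace.exp_series_hasSum_exp' (𝕂 := ℂ) ((t : ℂ) • 𝓛)).mapL
    (ContinuousLinearMap.apply ℂ E a)
  refine h.congr_fun fun n => ?_
  rw [smul_pow, smul_smul, ← Complex.coe_smul]; simp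

lemma flow_smul_one_add (Φ : E →L[ℂ] E) (c t : ℝ) (a : E) :
    flow ((c : ℂ) • (1 : E →L[ℂ] E) + Φ) t a = Real.exp (t * c) • flow Φ t a := by
  have h : Commute ((t : ℂ) • (c : ℂ) • (1 : E →L[ℂ] E)) ((t : ℂ) • Φ) :=
    (((Commute.one_left Φ).smul_left _).smul_left _).smul_right _
  have e : NormedSpace.exp ((t : ℂ) • (c : ℂ) • (1 : E →L[ℂ] E)) =
      Complex.exp (t * c) • (1 : E →L[ℂ] E) := by
    rw [smul_smul, ← Algebra.algebraMap_eq_smul_one, ← NormedSpace.algebraMap_exp_comm,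
      Algebra.algebraMap_eq_smul_one, Complex.exp_eq_exp_ℂ]
  rw [flow, smul_add, exp_add_of_commute_clm _ h, e, flow, ← Complex.coe_smul]
  simp

/-- A closed convex cone `S` is invariant under the semigroup generated by `𝓛` as soon as
`s⁻¹ + 𝓛 + s Γ` maps `S` into itself for all `s > 0`. -/
lemma flow_mem_of_cone {S : Set E} (hS : IsClosed S) (hadd : ∀ x ∈ S, ∀ y ∈ S, x + y ∈ S)
    (hsmul : ∀ c : ℝ, 0 ≤ c → ∀ x ∈ S, c • x ∈ S) (𝓛 Γ : E →L[ℂ] E)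
    (h : ∀ s : ℝ, 0 < s → ∀ x ∈ S, s⁻¹ • x + (𝓛 x + s • Γ x) ∈ S) {t : ℝ} (ht : 0 ≤ t) {a : E}
    (ha : a ∈ S) : flow 𝓛 t a ∈ S := by
  have h0 : (0 : E) ∈ S := by simpa using hsmul 0 le_rfl a ha
  have hpos : ∀ s : ℝ, 0 < s → flow (𝓛 + (s : ℂ) • Γ) t a ∈ S := by
    intro s hs
    -- Adding the scalar `s⁻¹` multiplies the semigroup by a positive number only, while the
    -- exponential series of the cone-preserving `Φ` has nonnegative coefficients.
    set Φ : E →L[ℂ] E := ((s⁻¹ : ℝ) : ℂ) • (1 : E →L[ℂ] E) + (𝓛 + (s : ℂ) • Γ) with hΦ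
    have hΦS : ∀ x ∈ S, Φ x ∈ S := by
      intro x hx
      have e : Φ x = s⁻¹ • x + (𝓛 x + s • Γ x) := by
        simp only [hΦ, ← Complex.coe_smul]
        rfl
      rw [e]
      exact h s hs x hx
    have hpow : ∀ n : ℕ, (Φ ^ n) a ∈ S := by
      intro n
      induction n with
      | zero => simpa
      | succ n ih => rw [pow_succ']; exact hΦS _ ih
    have hflow : flow Φ t a ∈ S := by
      refine hS.mem_of_tendsto (hasSum_flow Φ t a) (.of_forall fun F => ?_)
      refine Finset.sum_induction _ (· ∈ S) (fun x y hx hy => hadd x hx y hy) h0 fun n _ => ?_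
      exact hsmul _ (by positivity) _ (hpow n)
    have e : 𝓛 + (s : ℂ) • Γ = ((-s⁻¹ : ℝ) : ℂ) • (1 : E →L[ℂ] E) + Φ := by
      rw [hΦ, Complex.ofReal_neg, neg_smul, neg_add_cancel_left]
    rw [e, flow_smul_one_add]
    exact hsmul _ (Real.exp_pos _).le _ hflow
  have hlim : Tendsto (fun s : ℝ => flow (𝓛 + (s : ℂ) • Γ) t a) (𝓝[>] 0) (𝓝 (flow 𝓛 t a)) := by
    have hc : Continuous fun s : ℝ => flow (𝓛 + (s : ℂ) • Γ) t a := by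
      have : Continuous fun s : ℝ => NormedSpace.exp ((t : ℂ) • (𝓛 + (s : ℂ) • Γ)) := by
        let _ : NormedAlgebra ℚ (E →L[ℂ] E) := NormedAlgebra.restrictScalars ℚ ℂ _
        exact NormedSpace.exp_continuous.comp (by fun_prop)
      exact this.clm_apply continuous_const
    simpa using (hc.tendsto 0).mono_left (nhdsWithin_le_nhds (s := Ioi (0 : ℝ)))
  refine hS.mem_of_tendsto hlim ?_
  filter_upwards [self_mem_nhdsWithin] with s hs using hpos s hs

lemma map_flow {𝓛 : E →L[ℂ] E} {τ : E →L[ℝ] ℝ} (h : ∀ a, τ (𝓛 a) = 0) (t : ℝ) (a : E) :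
    τ (flow 𝓛 t a) = τ a := by
  have hd : ∀ s, HasDerivAt (fun t => τ (flow 𝓛 t a)) 0 s := fun s => by
    have := τ.hasFDerivAt.comp_hasDerivAt s (hasDerivAt_flow 𝓛 a s)
    rwa [h] at this
  have := is_const_of_deriv_eq_zero (fun s => (hd s).differentiableAt) (fun s => (hd s).deriv) t 0
  simpa [flow_zero] using this

end Flow

/-! ### Trace and positivity preservation for Lindblad generators. -/

section Lindblad

variable {A : Type*} [CStarAlgebra A] {𝓛 : A →L[ℂ] A} {τ : A →L[ℝ] ℝ}

/-- Generators in Lindblad form on a C⋆-algebra. -/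
def HasLindbladForm (𝓛 : A →L[ℂ] A) : Prop :=
  ∃ (K : A) (m : ℕ) (V : Fin m → A), IsSelfAdjoint K ∧
    ∀ X : A, 𝓛 X = -(Complex.I • (K * X - X * K)) +
      ∑ k, (V k * X * star (V k) -
        (1 / 2 : ℂ) • (star (V k) * V k * X + X * (star (V k) * V k)))

lemma HasLindbladForm.map_eq_zero (h : HasLindbladForm 𝓛) (hτ : ∀ a b, τ (a * b) = τ (b * a))
    (a : A) : τ (𝓛 a) = 0 := by
  obtain ⟨K, m, V, -, h⟩ := h
  have e1 : τ (Complex.I • (K * a - a * K)) = 0 := by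
    rw [smul_sub, map_sub, ← smul_mul_assoc, hτ, mul_smul_comm, sub_self]
  have e2 : ∀ k, τ (V k * a * star (V k) -
      (1 / 2 : ℂ) • (star (V k) * V k * a + a * (star (V k) * V k))) = 0 := by
    intro k
    have : (1 / 2 : ℂ) = ((1 / 2 : ℝ) : ℂ) := by norm_num
    rw [this, Complex.coe_smul, map_sub, map_smul, map_add, hτ a, hτ (V k * a), ← mul_assoc]
    simp only [smul_eq_mul]
    ring
  rw [h, map_add, map_neg, e1, map_sum, Finset.sum_eq_zero fun k _ => e2 k]
  simp

variable [PartialOrder A] [StarOrderedRing A]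

lemma HasLindbladForm.flow_nonneg (h : HasLindbladForm 𝓛) {t : ℝ} (ht : 0 ≤ t) {a : A}
    (ha : 0 ≤ a) : 0 ≤ flow 𝓛 t a := by
  obtain ⟨K, m, V, hK, h⟩ := h
  -- The drift `G` absorbs the Hamiltonian and the anticommutators, leaving `X ↦ G * X + X * star G`
  -- plus a sum of conjugations.
  set G : A := -(Complex.I • K) - (1 / 2 : ℂ) • ∑ k, star (V k) * V k with hG
  have hGs : star G = Complex.I • K - (1 / 2 : ℂ) • ∑ k, star (V k) * V k := by
    simp [hG, star_sub, star_smul, star_sum, hK.star_eq]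
  have h𝓛 : ∀ X, 𝓛 X = G * X + X * star G + ∑ k, V k * X * star (V k) := by
    intro X
    rw [h, hGs, hG, Finset.sum_sub_distrib, ← Finset.smul_sum, Finset.sum_add_distrib,
      ← Finset.sum_mul, ← Finset.mul_sum]
    simp only [sub_mul, mul_sub, neg_mul, smul_mul_assoc, mul_smul_comm, smul_add, smul_sub]
    abel
  set Γ : A →L[ℂ] A := ContinuousLinearMap.mulLeftRight ℂ A G (star G)
  refine flow_mem_of_cone (S := {x : A | 0 ≤ x}) isClosed_Ici (fun x hx y hy => add_nonneg hx hy)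
    (fun c hc x hx => smul_nonneg hc hx) 𝓛 Γ (fun s hs X hX => ?_) ht ha
  -- Completing the square: `s • Γ X` is the quadratic term that turns the drift part into a
  -- conjugation by `1 + s • G`.
  have e : s⁻¹ • X + (𝓛 X + s • Γ X) =
      s⁻¹ • ((1 + s • G) * X * star (1 + s • G)) + ∑ k, V k * X * star (V k) := by
    have : Γ X = G * X * star G := by simp [Γ]
    rw [this, h𝓛]
    simp only [star_add, star_one, star_smul, star_trivial, add_mul, mul_add, one_mul, mul_one,
      smul_mul_assoc, mul_smul_comm, smul_add, smul_smul, inv_mul_cancel₀ hs.ne', one_smul,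
      inv_mul_cancel_left₀ hs.ne']
    abel
  rw [Set.mem_ofPred_eq, e]
  exact add_nonneg (smul_nonneg (by positivity) (star_right_conjugate_nonneg hX _))
    (Finset.sum_nonneg fun k _ => star_right_conjugate_nonneg hX _)

end Lindblad

/-! ### Flow into the kernel, and integrability of the entropy rate. -/

section Dynamics

variable {A : Type*} [CStarAlgebra A] [PartialOrder A] [StarOrderedRing A]
  {𝓛 : A →L[ℂ] A} {τ : A →L[ℝ] ℝ}

lemma HasLindbladForm.map_mul_nonneg (h : HasLindbladForm 𝓛) (hτ : IsFaithfulTrace τ) {s n : A}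
    (hs : 0 ≤ s) (hn : 0 ≤ n) (hsn : s * n = 0) : 0 ≤ τ (𝓛 s * n) := by
  have hd := τ.hasFDerivAt.comp_hasDerivWithinAt 0
    ((hasTangent_flow 𝓛 s).hasDerivWithinAt.mul_const n)
  rw [hasDerivWithinAt_iff_tendsto_slope' (by simp)] at hd
  refine ge_of_tendsto hd ?_
  filter_upwards [self_mem_nhdsWithin] with t ht
  have ht : 0 < t := ht
  rw [slope_def_field, Function.comp_apply, Function.comp_apply, flow_zero, hsn, map_zero, sub_zero,
    sub_zero]
  exact div_nonneg (hτ.map_mul_nonneg (h.flow_nonneg ht.le hs) hn) ht.le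

/-- The corner `n * 𝓛 s * n` is a limit of positive elements, being the derivative at `0` of a
positive curve that starts at `0`. Its trace vanishes, so faithfulness applies. -/
lemma HasLindbladForm.conj_eq_zero (h : HasLindbladForm 𝓛) (hτ : IsFaithfulTrace τ) {s n : A}
    (hs : 0 ≤ s) (hn : IsSelfAdjoint n) (hnn : n * n = n) (hsn : s * n = 0)
    (h0 : τ (𝓛 s * n) = 0) : n * 𝓛 s * n = 0 := by
  have hpos : 0 ≤ n * 𝓛 s * n := by
    have hd := ((hasTangent_flow 𝓛 s).hasDerivWithinAt.const_mul n).mul_const n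
    rw [hasDerivWithinAt_iff_tendsto_slope' (by simp)] at hd
    refine ge_of_tendsto hd ?_
    filter_upwards [self_mem_nhdsWithin] with t ht
    have ht : 0 < t := ht
    rw [slope, vsub_eq_sub, flow_zero, mul_assoc n s, hsn, mul_zero, sub_zero, sub_zero]
    refine smul_nonneg (by positivity) ?_
    have := star_left_conjugate_nonneg (h.flow_nonneg ht.le hs) n
    rwa [hn.star_eq] at this
  refine hτ.eq_zero hpos ?_
  rw [hτ.map_mul_comm, ← mul_assoc, hnn, hτ.map_mul_comm, h0]

/-- Both `s` and `C • f - s` flow into the range of `n` at nonnegative rates, and these rates sum to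
zero. -/
lemma HasLindbladForm.map_mul_eq_zero_of_le (h : HasLindbladForm 𝓛) (hτ : IsFaithfulTrace τ)
    {f s n : A} (hs : 0 ≤ s) {C : ℝ} (hsf : s ≤ C • f) (hn : 0 ≤ n) (hfn : f * n = 0)
    (h0 : τ (𝓛 f * n) = 0) : τ (𝓛 s * n) = 0 := by
  have hfn' : (C • f) * n = 0 := by rw [smul_mul_assoc, hfn, smul_zero]
  have hsn := mul_eq_zero_of_le hs hsf hfn'
  have h1 := h.map_mul_nonneg hτ hs hn hsn
  have h2 := h.map_mul_nonneg hτ (sub_nonneg.mpr hsf) hn (by rw [sub_mul, hfn', hsn, sub_zero])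
  rw [map_sub, map_real_smul, sub_mul, map_sub, smul_mul_assoc, map_smul, h0, smul_zero,
    zero_sub] at h2
  linarith

variable [FiniteDimensional ℂ A]

/-- The weight in the kernel at time `s` is nonnegative at nearby times and zero at `s`. As `s > 0`
is interior, this is a two-sided minimum, so the entropy rate can be infinite only at the initial
time. -/
lemma HasLindbladForm.map_mul_kerProj_flow (h : HasLindbladForm 𝓛) (hτ : IsFaithfulTrace τ) {f : A}
    (hf : 0 ≤ f) {s : ℝ} (hs : 0 < s) : τ (𝓛 (flow 𝓛 s f) * kerProj (flow 𝓛 s f)) = 0 := by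
  set n := kerProj (flow 𝓛 s f)
  have hd := τ.hasFDerivAt.comp_hasDerivAt s ((hasDerivAt_flow 𝓛 f s).mul_const n)
  refine IsLocalMin.hasDerivAt_eq_zero ?_ hd
  filter_upwards [eventually_gt_nhds hs] with u hu
  simp only [Function.comp_apply]
  rw [mul_kerProj (h.flow_nonneg hs.le hf).isSelfAdjoint, map_zero]
  exact hτ.map_mul_nonneg (h.flow_nonneg hu.le hf) (kerProj_nonneg _)

lemma HasLindbladForm.hasDerivWithinAt_flow (h : HasLindbladForm 𝓛) (hτ : IsFaithfulTrace τ) {f : A}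
    (hf : 0 ≤ f) (hf1 : f ≤ 1) (h0 : τ (𝓛 f * kerProj f) = 0) :
    HasDerivWithinAt (fun t => τ (flow 𝓛 t f * CFC.log (flow 𝓛 t f))) (τ (𝓛 f * CFC.log f))
      (Ioi 0) 0 := by
  have := hasDerivWithinAt_map_mul_log_self hτ (hasTangent_flow 𝓛 f) (by rwa [flow_zero])
    (by rwa [flow_zero]) ?_ (h.map_eq_zero hτ.map_mul_comm f)
    (by filter_upwards [self_mem_nhdsWithin] with t ht using h.flow_nonneg (le_of_lt ht) hf)
  · simpa only [flow_zero] using this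
  · rw [flow_zero]
    exact h.conj_eq_zero hτ hf (isSelfAdjoint_kerProj f) (kerProj_mul_self f)
      (mul_kerProj hf.isSelfAdjoint) h0

lemma HasLindbladForm.tendsto_slope_flow_atTop (h : HasLindbladForm 𝓛) (hτ : IsFaithfulTrace τ)
    {f : A} (hf : 0 ≤ f) (hf1 : f ≤ 1) (h0 : τ (𝓛 f * kerProj f) ≠ 0) :
    Tendsto (fun t => (τ (f * CFC.log f) - τ (flow 𝓛 t f * CFC.log (flow 𝓛 t f))) / t)
      (𝓝[>] 0) atTop := by
  have := tendsto_slope_map_mul_log_atTop hτ (hasTangent_flow 𝓛 f) (by rwa [flow_zero])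
    (by rwa [flow_zero]) (by
      rw [flow_zero]
      exact lt_of_le_of_ne (h.map_mul_nonneg hτ hf (kerProj_nonneg f)
        (mul_kerProj hf.isSelfAdjoint)) h0.symm)
    (by filter_upwards [self_mem_nhdsWithin] with t ht using h.flow_nonneg (le_of_lt ht) hf)
  simpa only [flow_zero] using this

omit [PartialOrder A] [StarOrderedRing A] in
lemma mul_log_eq_cfc {a : A} (ha : IsSelfAdjoint a) :
    a * CFC.log a = cfc (fun x => x * Real.log x) a := by
  rw [cfc_mul _ _ _ (continuousOn_spectrum _ _) (continuousOn_spectrum _ _), cfc_id' ℝ a, CFC.log]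

omit [PartialOrder A] [StarOrderedRing A] in
lemma log_mul_self {a : A} (ha : IsSelfAdjoint a) : CFC.log a * a = a * CFC.log a := by
  have := congrArg star (mul_log_eq_cfc ha)
  have h : IsSelfAdjoint (cfc (fun x : ℝ => x * Real.log x) a) := cfc_predicate _ a
  rw [star_mul, ha.star_eq, IsSelfAdjoint.log.star_eq, h.star_eq] at this
  rw [this, mul_log_eq_cfc ha]

lemma spectrum_subset_Icc {a : A} (ha : 0 ≤ a) (h1 : a ≤ 1) : spectrum ℝ a ⊆ Icc 0 1 := by
  intro x hx
  refine ⟨spectrum_nonneg_of_nonneg ha hx, ?_⟩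
  have hs : IsSelfAdjoint a := ha.isSelfAdjoint
  rw [← cfc_id' ℝ a, ← cfc_const_one ℝ a, cfc_le_iff _ _ _ (continuousOn_spectrum _ _)
    (continuousOn_spectrum _ _)] at h1
  exact h1 x hx

lemma log_nonpos {a : A} (ha : 0 ≤ a) (h1 : a ≤ 1) : CFC.log a ≤ 0 := by
  rw [CFC.log, ← cfc_zero (R := ℝ) (a := a)]
  refine cfc_mono (fun x hx => ?_) (continuousOn_spectrum _ _) (continuousOn_spectrum _ _)
  have := spectrum_subset_Icc ha h1 hx
  exact Real.log_nonpos this.1 this.2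

lemma neg_one_le_mul_log {a : A} (ha : 0 ≤ a) (h1 : a ≤ 1) : -1 ≤ a * CFC.log a := by
  have hs : IsSelfAdjoint a := ha.isSelfAdjoint
  rw [mul_log_eq_cfc hs, ← cfc_const_one ℝ a, ← cfc_neg]
  refine cfc_mono (fun x hx => ?_) (continuousOn_spectrum _ _) (continuousOn_spectrum _ _)
  have h2 := spectrum_subset_Icc ha h1 hx
  rcases h2.1.eq_or_lt with h0 | h0
  · simp [← h0]
  · have h3 := Real.one_sub_inv_le_log_of_pos h0
    have h4 := mul_le_mul_of_nonneg_left h3 h2.1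
    rw [mul_sub, mul_inv_cancel₀ h0.ne'] at h4
    linarith

/-- The commutator drops out because `log a` commutes with `a`. The gain term is nonpositive since
`log a ≤ 0`, and the loss term is controlled by `a * log a ≥ -1`. The bound makes the entropy rate
bounded below uniformly, which is what integrability needs. -/
lemma HasLindbladForm.exists_map_mul_log_le (h : HasLindbladForm 𝓛) (hτ : IsFaithfulTrace τ) :
    ∃ C : ℝ, ∀ a : A, 0 ≤ a → a ≤ 1 → τ (𝓛 a * CFC.log a) ≤ C := by
  obtain ⟨K, m, V, -, h⟩ := h
  refine ⟨∑ k, τ (star (V k) * V k), fun a ha h1 => ?_⟩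
  set D := CFC.log a
  have hD : D * a = a * D := log_mul_self ha.isSelfAdjoint
  have e1 : τ (Complex.I • (K * a - a * K) * D) = 0 := by
    rw [smul_sub, sub_mul, map_sub, sub_eq_zero]
    calc τ (Complex.I • (K * a) * D) = τ (Complex.I • (K * (D * a))) := by
          rw [hD, smul_mul_assoc, mul_assoc]
      _ = τ ((Complex.I • (K * D)) * a) := by rw [smul_mul_assoc, mul_assoc]
      _ = τ (a * (Complex.I • (K * D))) := hτ.map_mul_comm _ _
      _ = _ := by rw [mul_smul_comm, smul_mul_assoc, mul_assoc]
  have e2 : ∀ k, τ ((V k * a * star (V k) -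
      (1 / 2 : ℂ) • (star (V k) * V k * a + a * (star (V k) * V k))) * D) ≤
      τ (star (V k) * V k) := by
    intro k
    have hhalf : (1 / 2 : ℂ) = ((1 / 2 : ℝ) : ℂ) := by norm_num
    set W := star (V k) * V k with hW
    have hWpos : 0 ≤ W := star_mul_self_nonneg _
    have a1 : τ (V k * a * star (V k) * D) ≤ 0 := by
      have := hτ.map_mul_mono (star_right_conjugate_nonneg ha (V k)) (log_nonpos ha h1)
      rwa [mul_zero, map_zero] at this
    have a2 : τ (W * (a * D)) ≥ -τ W := by
      have := hτ.map_mul_mono hWpos (neg_one_le_mul_log ha h1)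
      rwa [mul_neg, mul_one, map_neg] at this
    have a3 : τ (a * W * D) = τ (W * (a * D)) := by
      rw [mul_assoc, hτ.map_mul_comm, mul_assoc, hD]
    rw [hhalf, Complex.coe_smul, sub_mul, map_sub, smul_mul_assoc, map_smul, add_mul, map_add, a3,
      mul_assoc W, smul_eq_mul]
    linarith
  rw [h, add_mul, neg_mul, map_add, map_neg, e1, Finset.sum_mul, map_sum, neg_zero, zero_add]
  exact Finset.sum_le_sum fun k _ => e2 k

/-- Unlike `log`, the function `x * log x` is continuous at `0`, so changes of support do no harm.
-/
lemma continuousOn_map_mul_log {f : ℝ → A} {s : Set ℝ} (hf : ContinuousOn f s)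
    (h0 : ∀ t ∈ s, 0 ≤ f t) (h1 : ∀ t ∈ s, f t ≤ 1) (τ : A →L[ℝ] ℝ) :
    ContinuousOn (fun t => τ (f t * CFC.log (f t))) s := by
  have hc : ContinuousOn (fun t => cfc (fun x => x * Real.log x) (f t)) s :=
    hf.cfc' isCompact_Icc _ (fun t ht => spectrum_subset_Icc (h0 t ht) (h1 t ht))
      (fun t ht => (h0 t ht).isSelfAdjoint) Real.continuous_mul_log.continuousOn
  refine (τ.continuous.comp_continuousOn hc).congr fun t ht => ?_
  simp only [Function.comp_apply, mul_log_eq_cfc (h0 t ht).isSelfAdjoint]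

omit [FiniteDimensional ℂ A] in
lemma HasLindbladForm.flow_le_one (h : HasLindbladForm 𝓛) (hτ : IsFaithfulTrace τ) {f : A}
    (hf : 0 ≤ f) (hf1 : τ f = 1) {t : ℝ} (ht : 0 ≤ t) : flow 𝓛 t f ≤ 1 := by
  have := hτ.le_smul_one _ (h.flow_nonneg ht hf)
  rwa [map_flow (h.map_eq_zero hτ.map_mul_comm), hf1, one_smul] at this

/-- The entropy rate at `flow 𝓛 s f`. -/
def flowRate (𝓛 : A →L[ℂ] A) (τ : A →L[ℝ] ℝ) (f : A) (s : ℝ) : ℝ :=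
  -τ (𝓛 (flow 𝓛 s f) * CFC.log (flow 𝓛 s f))

lemma HasLindbladForm.integral_flowRate (h : HasLindbladForm 𝓛) (hτ : IsFaithfulTrace τ) {f : A}
    (hf : 0 ≤ f) (hf1 : τ f = 1) {T : ℝ} (hT : 0 ≤ T) :
    IntervalIntegrable (flowRate 𝓛 τ f) volume 0 T ∧
      ∫ s in (0 : ℝ)..T, flowRate 𝓛 τ f s =
        τ (f * CFC.log f) - τ (flow 𝓛 T f * CFC.log (flow 𝓛 T f)) := by
  obtain ⟨C, hC⟩ := h.exists_map_mul_log_le hτ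
  set g : ℝ → ℝ := fun t => -τ (flow 𝓛 t f * CFC.log (flow 𝓛 t f)) with hg
  have hcont : ContinuousOn g (Icc 0 T) :=
    (continuousOn_map_mul_log (continuous_flow 𝓛 f).continuousOn
      (fun t ht => h.flow_nonneg ht.1 hf) (fun t ht => h.flow_le_one hτ hf hf1 ht.1) τ).neg
  have hder : ∀ s ∈ Ioo 0 T, HasDerivWithinAt g (flowRate 𝓛 τ f s) (Ioi s) s := by
    intro s hs
    have h1 := (h.hasDerivWithinAt_flow hτ (h.flow_nonneg hs.1.le hf)
      (h.flow_le_one hτ hf hf1 hs.1.le) (h.map_mul_kerProj_flow hτ hf hs.1)).neg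
    have h2 : HasDerivWithinAt (fun u : ℝ => u - s) 1 (Ioi s) s :=
      ((hasDerivAt_id s).sub_const s).hasDerivWithinAt
    -- By the semigroup law, the right derivative at `s` is the one at `0` for the state reached at
    -- time `s`.
    have h3 := HasDerivWithinAt.scomp_of_eq (h := fun u : ℝ => u - s) (t' := Ioi 0) s h1 h2
      (fun u hu => by simpa using hu) (by simp)
    rw [one_smul] at h3
    refine h3.congr (fun u _ => ?_) ?_
    · simp [hg, ← flow_add]
    · simp [hg, ← flow_add]
  -- Adding `C` makes the derivative nonnegative, and a nonnegative right derivative of a continuous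
  -- function is integrable.
  have hint : IntegrableOn (fun s => flowRate 𝓛 τ f s + C) (Ioc 0 T) volume := by
    refine intervalIntegral.integrableOn_deriv_right_of_nonneg (g := fun s => g s + C * s)
      (hcont.add (by fun_prop)) (fun s hs => ?_) (fun s hs => ?_)
    · have := (hder s hs).add ((hasDerivWithinAt_id s (Ioi s)).const_mul C)
      rw [mul_one] at this
      exact this
    · have := hC _ (h.flow_nonneg hs.1.le hf) (h.flow_le_one hτ hf hf1 hs.1.le)
      rw [flowRate]
      linarith
  have hint' : IntervalIntegrable (flowRate 𝓛 τ f) volume 0 T := by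
    rw [intervalIntegrable_iff_integrableOn_Ioc_of_le hT]
    have := hint.sub (integrableOn_const (C := C) (s := Ioc 0 T) (by simp))
    exact this.congr_fun (fun s _ => by simp) measurableSet_Ioc
  refine ⟨hint', ?_⟩
  rw [intervalIntegral.integral_eq_sub_of_hasDeriv_right_of_le hT hcont hder hint']
  simp only [hg, flow_zero]
  ring

end Dynamics

lemma contDiffOn_logSeries {B : Type*} [NormedRing B] [NormedAlgebra ℝ B] [CompleteSpace B] :
    ContDiffOn ℝ 1 (logSeries : B → B) (Metric.ball 1 1) := by
  have h : ∀ x ∈ Metric.ball (1 : B) 1, ‖1 - x‖ < 1 := fun x hx => by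
    rwa [← ball_one_eq] at hx
  rw [show (1 : WithTop ℕ∞) = 0 + 1 by simp, contDiffOn_succ_iff_fderiv_of_isOpen
    Metric.isOpen_ball]
  refine ⟨fun x hx => (hasFDerivAt_logSeries (h x hx)).differentiableAt.differentiableWithinAt,
    by simp, ?_⟩
  rw [contDiffOn_zero]
  refine ContinuousOn.congr (f := logDeriv) (fun x hx =>
    (continuousAt_logDeriv (h x hx)).continuousWithinAt) fun x hx =>
    (hasFDerivAt_logSeries (h x hx)).fderiv

/-! ### The segment from `f` towards `r`, and the two mixed derivatives. -/

section Line

variable {A : Type*} [CStarAlgebra A] [PartialOrder A] [StarOrderedRing A]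
  [FiniteDimensional ℂ A] {𝓛 : A →L[ℂ] A} {τ : A →L[ℝ] ℝ} {f r : A}

omit [PartialOrder A] [StarOrderedRing A] in
lemma line_mul_kerProj (hf : IsSelfAdjoint f) (hrf : r * kerProj f = 0) (l : ℝ) :
    (f + l • (r - f)) * kerProj f = 0 := by
  rw [add_mul, smul_mul_assoc, sub_mul, hrf, mul_kerProj hf, sub_zero, smul_zero, add_zero]

lemma exists_half_le_line (hf : 0 ≤ f) (hr : 0 ≤ r) (hrf : r * kerProj f = 0) :
    ∃ ε : ℝ, 0 < ε ∧ ε < 1 ∧ ∀ l : ℝ, |l| ≤ ε → (1 / 2 : ℝ) • f ≤ f + l • (r - f) := by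
  obtain ⟨C, hC0, hC⟩ := exists_le_smul_of_mul_kerProj hf hr.isSelfAdjoint hrf
  -- The bound `1 / 2` serves `l ≥ 0`, where the coefficient of `f` is `1 - l`; the bound `1 / (2 *
  -- C)` serves `l ≤ 0`, where `r ≤ C • f` is needed.
  refine ⟨min (1 / 2) (1 / (2 * C)), by positivity,
    (min_le_left _ _).trans_lt (by norm_num), fun l hl => ?_⟩
  have h1 := hl.trans (min_le_left _ _)
  have h2 := hl.trans (min_le_right _ _)
  rcases le_total 0 l with h | h
  · rw [abs_of_nonneg h] at h1
    calc (1 / 2 : ℝ) • f ≤ (1 - l) • f := smul_le_smul_of_nonneg_right (by linarith) hf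
      _ ≤ (1 - l) • f + l • r := le_add_of_nonneg_right (smul_nonneg h hr)
      _ = _ := by module
  · rw [abs_of_nonpos h, le_div_iff₀ (by positivity)] at h2
    calc (1 / 2 : ℝ) • f ≤ (1 - l + l * C) • f := smul_le_smul_of_nonneg_right (by linarith) hf
      _ = (1 - l) • f - (-l) • (C • f) := by module
      _ ≤ (1 - l) • f - (-l) • r :=
          sub_le_sub_left (smul_le_smul_of_nonneg_left hC (by linarith)) _
      _ = _ := by module

lemma kerProj_line (hf : 0 ≤ f) (hrf : r * kerProj f = 0) {l : ℝ}
    (hl : (1 / 2 : ℝ) • f ≤ f + l • (r - f)) : kerProj (f + l • (r - f)) = kerProj f :=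
  kerProj_eq_of_le hf (by norm_num) hl (line_mul_kerProj hf.isSelfAdjoint hrf l)

omit [PartialOrder A] [StarOrderedRing A] [FiniteDimensional ℂ A] in
lemma map_line (hf1 : τ f = 1) (hr1 : τ r = 1) (l : ℝ) : τ (f + l • (r - f)) = 1 := by
  simp [hf1, hr1]

omit [FiniteDimensional ℂ A] in
lemma line_nonneg (hf : 0 ≤ f) {l : ℝ} (hl : (1 / 2 : ℝ) • f ≤ f + l • (r - f)) :
    0 ≤ f + l • (r - f) :=
  (smul_nonneg (by norm_num) hf).trans hl

omit [StarOrderedRing A] [FiniteDimensional ℂ A] in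
lemma IsFaithfulTrace.le_one (hτ : IsFaithfulTrace τ) (hf : 0 ≤ f) (hf1 : τ f = 1) : f ≤ 1 := by
  simpa [hf1] using hτ.le_smul_one f hf

lemma norm_one_sub_line_add_lt (hτ : IsFaithfulTrace τ) (hf : 0 ≤ f) (hf1 : τ f = 1)
    (hr1 : τ r = 1) (hrf : r * kerProj f = 0) {l : ℝ} (hl : (1 / 2 : ℝ) • f ≤ f + l • (r - f)) :
    ‖1 - (f + l • (r - f) + kerProj f)‖ < 1 := by
  rw [← kerProj_line hf hrf hl]
  exact norm_one_sub_add_kerProj_lt (line_nonneg hf hl)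
    (hτ.le_one (line_nonneg hf hl) (map_line hf1 hr1 l))

lemma log_line (hτ : IsFaithfulTrace τ) (hf : 0 ≤ f) (hf1 : τ f = 1)
    (hr1 : τ r = 1) (hrf : r * kerProj f = 0) {l : ℝ} (hl : (1 / 2 : ℝ) • f ≤ f + l • (r - f)) :
    CFC.log (f + l • (r - f)) = logSeries (f + l • (r - f) + kerProj f) := by
  have h := norm_one_sub_line_add_lt hτ hf hf1 hr1 hrf hl
  have hs : IsSelfAdjoint (f + l • (r - f)) := (line_nonneg hf hl).isSelfAdjoint
  rw [← kerProj_line hf hrf hl] at h ⊢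
  exact (logSeries_add_kerProj hs h).symm

lemma HasLindbladForm.map_mul_kerProj_line (h : HasLindbladForm 𝓛) (hτ : IsFaithfulTrace τ)
    (hf : 0 ≤ f) (hrf : r * kerProj f = 0) (h0 : τ (𝓛 f * kerProj f) = 0) {l : ℝ}
    (hl : (1 / 2 : ℝ) • f ≤ f + l • (r - f)) :
    τ (𝓛 (f + l • (r - f)) * kerProj (f + l • (r - f))) = 0 := by
  obtain ⟨C, -, hC⟩ := exists_le_smul_of_mul_kerProj hf (line_nonneg hf hl).isSelfAdjoint
    (line_mul_kerProj hf.isSelfAdjoint hrf l)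
  rw [kerProj_line hf hrf hl]
  exact h.map_mul_eq_zero_of_le hτ (line_nonneg hf hl) hC (kerProj_nonneg f)
    (mul_kerProj hf.isSelfAdjoint) h0

/-- The derivative along a segment of the entropy rate, at its end point `f`. -/
def rateDeriv (𝓛 : A →L[ℂ] A) (τ : A →L[ℝ] ℝ) (f r : A) : ℝ :=
  -(τ (𝓛 (r - f) * CFC.log f) + τ (𝓛 f * logDeriv (f + kerProj f) (r - f)))

lemma hasDerivAt_rate_line (𝓛 : A →L[ℂ] A) (hτ : IsFaithfulTrace τ) (hf : 0 ≤ f) (hf1 : τ f = 1) :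
    HasDerivAt (fun l : ℝ => -τ (𝓛 (f + l • (r - f)) * logSeries (f + l • (r - f) + kerProj f)))
      (rateDeriv 𝓛 τ f r) 0 := by
  have hn := norm_one_sub_add_kerProj_lt hf (hτ.le_one hf hf1)
  have hline : HasDerivAt (fun l : ℝ => f + l • (r - f)) (r - f) 0 := by
    simpa using ((hasDerivAt_id (0 : ℝ)).smul_const (r - f)).const_add f
  have h𝓛 : HasDerivAt (fun l : ℝ => 𝓛 (f + l • (r - f))) (𝓛 (r - f)) 0 := by
    have : (fun l : ℝ => 𝓛 (f + l • (r - f))) = fun l : ℝ => 𝓛 f + l • 𝓛 (r - f) := by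
      ext l; rw [map_add, map_real_smul]
    rw [this]
    simpa using ((hasDerivAt_id (0 : ℝ)).smul_const (𝓛 (r - f))).const_add (𝓛 f)
  have h2 := (hasDerivWithinAt_map_mul_logSeries (s := univ) h𝓛.hasDerivWithinAt
    (hline.add_const (kerProj f)).hasDerivWithinAt (by simpa using hn) τ).neg
  rw [hasDerivWithinAt_univ] at h2
  refine h2.congr_deriv ?_
  simp only [zero_smul, add_zero, rateDeriv]
  rw [logSeries_add_kerProj hf.isSelfAdjoint hn]

omit [PartialOrder A] [StarOrderedRing A] [FiniteDimensional ℂ A] in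
lemma contDiffOn_rate_line (𝓛 : A →L[ℂ] A) (τ : A →L[ℝ] ℝ) {s : Set ℝ}
    (hs : ∀ l ∈ s, ‖1 - (f + l • (r - f) + kerProj f)‖ < 1) :
    ContDiffOn ℝ 1 (fun l : ℝ =>
      -τ (𝓛 (f + l • (r - f)) * logSeries (f + l • (r - f) + kerProj f))) s := by
  have h1 : ContDiffOn ℝ 1 (fun l : ℝ => logSeries (f + l • (r - f) + kerProj f)) s := by
    refine contDiffOn_logSeries.comp (by fun_prop) fun l hl => ?_
    rw [← ball_one_eq]
    exact hs l hl
  have h2 : ContDiff ℝ 1 (fun l : ℝ => 𝓛 (f + l • (r - f))) := by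
    have : (fun l : ℝ => 𝓛 (f + l • (r - f))) = fun l : ℝ => 𝓛 f + l • 𝓛 (r - f) := by
      ext l; rw [map_add, map_real_smul]
    rw [this]
    fun_prop
  exact (τ.contDiff.comp_contDiffOn (h2.contDiffOn.mul h1)).neg

/-- After trace symmetry the compression can be moved onto `logDeriv (f + kerProj f) r`, which
`kerProj f` annihilates on both sides because it annihilates `r`. -/
lemma map_mul_logDeriv_eq (hτ : IsFaithfulTrace τ) (hf : 0 ≤ f) (hf1 : f ≤ 1)
    (hr : IsSelfAdjoint r) (hrf : r * kerProj f = 0) (b : A) :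
    τ (r * logDeriv (f + kerProj f) (compress f b)) = τ (b * logDeriv (f + kerProj f) r) := by
  have hn := norm_one_sub_add_kerProj_lt hf hf1
  have hc := commute_kerProj_add hf.isSelfAdjoint
  have hrf' : kerProj f * r = 0 := by
    have := congrArg star hrf
    rwa [star_mul, (isSelfAdjoint_kerProj f).star_eq, hr.star_eq, star_zero] at this
  have e1 : kerProj f * logDeriv (f + kerProj f) r = 0 := by
    rw [mul_logDeriv hn hc, hrf', map_zero]
  have e2 : logDeriv (f + kerProj f) r * kerProj f = 0 := by
    rw [logDeriv_mul hn hc, hrf, map_zero]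
  rw [trace_mul_logDeriv hn τ hτ.map_mul_comm, compress, mul_assoc, mul_assoc, hτ.map_mul_comm,
    mul_assoc, mul_assoc, mul_sub, mul_one, e2, sub_zero, sub_mul, one_mul, e1, sub_zero]

/-- The time derivative differentiates the logarithm in direction `𝓛 f`, whereas `rateDeriv` does so
in direction `r - f`. Symmetry of `logDeriv` under the trace exchanges the two directions. -/
lemma HasLindbladForm.hasDerivWithinAt_mixed (h : HasLindbladForm 𝓛) (hτ : IsFaithfulTrace τ)
    (hf : 0 ≤ f) (hf1 : τ f = 1) (hr : 0 ≤ r) (hrf : r * kerProj f = 0)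
    (h0 : τ (𝓛 f * kerProj f) = 0) :
    HasDerivWithinAt (fun t => -τ (flow 𝓛 t (r - f) * CFC.log (flow 𝓛 t f)))
      (rateDeriv 𝓛 τ f r) (Ioi 0) 0 := by
  have hfle := hτ.le_one hf hf1
  obtain ⟨C, hC0, hC⟩ := exists_le_smul_of_mul_kerProj hf hr.isSelfAdjoint hrf
  have hconj := h.conj_eq_zero hτ hf (isSelfAdjoint_kerProj f) (kerProj_mul_self f)
    (mul_kerProj hf.isSelfAdjoint) h0
  have h𝓛 := h.map_eq_zero hτ.map_mul_comm f
  have d1 := hasDerivWithinAt_map_mul_log hτ (hasTangent_flow 𝓛 f) (hasTangent_flow 𝓛 r)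
    (by rwa [flow_zero]) (by rwa [flow_zero]) (by rwa [flow_zero]) h𝓛 (C := C)
    (by
      filter_upwards [self_mem_nhdsWithin] with t ht
      have ht : 0 ≤ t := le_of_lt ht
      refine ⟨h.flow_nonneg ht hf, h.flow_nonneg ht hr, ?_⟩
      have := h.flow_nonneg ht (sub_nonneg.mpr hC)
      rwa [flow_map_sub, flow_map_smul, sub_nonneg] at this)
    (by rwa [flow_zero, flow_zero])
    (by
      rw [flow_zero]
      exact h.map_mul_eq_zero_of_le hτ hr hC (kerProj_nonneg f) (mul_kerProj hf.isSelfAdjoint) h0)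
  have d2 := h.hasDerivWithinAt_flow hτ hf hfle h0
  have d3 := (d1.sub d2).neg
  simp only [flow_zero] at d3
  refine (d3.congr_deriv ?_).congr (fun t _ => ?_) ?_
  · have e1 := map_mul_logDeriv_eq hτ hf hfle hr.isSelfAdjoint hrf (𝓛 f)
    have e2 := map_mul_logDeriv_eq hτ hf hfle hf.isSelfAdjoint (mul_kerProj hf.isSelfAdjoint) (𝓛 f)
    rw [map_mul_logDeriv_compress hτ hf hfle, map_compress hτ, hconj, h𝓛, map_zero, sub_zero] at e2
    rw [e1, rateDeriv, map_sub, map_sub, sub_mul, mul_sub, map_sub, map_sub, ← e2]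
    ring
  · simp only [flow_map_sub, sub_mul, map_sub]
    rfl
  · simp only [flow_map_sub, sub_mul, map_sub]
    rfl

/-- At fixed `t`, domination of `r` by `f` survives the flow, so the evolved segment stays within
the support of `flow 𝓛 t f` and the formula for `τ (γ log γ)` applies to a straight line. -/
lemma HasLindbladForm.hasDerivWithinAt_line (h : HasLindbladForm 𝓛) (hτ : IsFaithfulTrace τ)
    (hf : 0 ≤ f) (hf1 : τ f = 1) (hr : 0 ≤ r) (hr1 : τ r = 1) (hrf : r * kerProj f = 0)
    {t : ℝ} (ht : 0 ≤ t) :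
    HasDerivWithinAt (fun l : ℝ =>
        -τ (flow 𝓛 t (f + l • (r - f)) * CFC.log (flow 𝓛 t (f + l • (r - f)))))
      (-τ (flow 𝓛 t (r - f) * CFC.log (flow 𝓛 t f))) (Ioi 0) 0 := by
  obtain ⟨C, hC0, hC⟩ := exists_le_smul_of_mul_kerProj hf hr.isSelfAdjoint hrf
  have hft := h.flow_nonneg ht hf
  have hC' : flow 𝓛 t r ≤ C • flow 𝓛 t f := by
    have := h.flow_nonneg ht (sub_nonneg.mpr hC)
    rwa [flow_map_sub, flow_map_smul, sub_nonneg] at this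
  have hrt : flow 𝓛 t r * kerProj (flow 𝓛 t f) = 0 :=
    mul_eq_zero_of_le (h.flow_nonneg ht hr) hC'
      (by rw [smul_mul_assoc, mul_kerProj hft.isSelfAdjoint, smul_zero])
  have e : ∀ l : ℝ, flow 𝓛 t (f + l • (r - f)) = flow 𝓛 t f + l • flow 𝓛 t (r - f) :=
    fun l => by rw [flow_map_add, flow_map_smul]
  have d := (hasDerivWithinAt_map_mul_log_self hτ
    (HasTangent.line (flow 𝓛 t f) (flow 𝓛 t (r - f)))
    (by simpa using hft) (by simpa using h.flow_le_one hτ hf hf1 ht)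
    (by
      rw [zero_smul, add_zero, mul_assoc, flow_map_sub, sub_mul, hrt,
        mul_kerProj hft.isSelfAdjoint, sub_zero, mul_zero])
    (by rw [map_flow (h.map_eq_zero hτ.map_mul_comm), map_sub, hf1, hr1, sub_self])
    (by
      have hsmall : ∀ᶠ l in 𝓝[>] (0 : ℝ), l < 1 :=
        (nhdsWithin_le_nhds (s := Ioi (0 : ℝ))) (eventually_lt_nhds one_pos)
      filter_upwards [hsmall, self_mem_nhdsWithin] with l hl1 hl0
      have hl0 : 0 < l := hl0
      rw [← e]
      refine h.flow_nonneg ht ?_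
      have : f + l • (r - f) = (1 - l) • f + l • r := by module
      rw [this]
      exact add_nonneg (smul_nonneg (by linarith) hf) (smul_nonneg hl0.le hr))).neg
  simp only [zero_smul, add_zero] at d
  simp only [e]
  exact d

end Line

/-! ### Linear extension of mixture-compatible functions. -/

section Affine

variable {E : Type*} [AddCommGroup E] [Module ℝ E] {F : Set E} {f : E → ℝ}

lemma map_sum_smul_of_convexOn_of_concaveOn (hcv : ConvexOn ℝ F f) (hcc : ConcaveOn ℝ F f)
    {ι : Type*} {s : Finset ι} {w : ι → ℝ} {p : ι → E} (hw : ∀ i ∈ s, 0 ≤ w i)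
    (hm : 0 < ∑ i ∈ s, w i) (hp : ∀ i ∈ s, p i ∈ F) :
    ∑ i ∈ s, w i * f (p i) = (∑ i ∈ s, w i) * f ((∑ i ∈ s, w i)⁻¹ • ∑ i ∈ s, w i • p i) := by
  have h := le_antisymm (hcv.map_centerMass_le hw hm hp) (hcc.le_map_centerMass hw hm hp)
  simp only [Finset.centerMass, Function.comp_apply, smul_eq_mul] at h
  rw [h, mul_inv_cancel_left₀ hm.ne']

/-- A function that is compatible with mixtures extends to a linear functional, provided that its
domain lies in an affine hyperplane missing the origin. -/
lemma exists_linearMap_eq_of_convexOn_of_concaveOn (hcv : ConvexOn ℝ F f) (hcc : ConcaveOn ℝ F f)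
    (τ : E →ₗ[ℝ] ℝ) (hτ : ∀ x ∈ F, τ x = 1) : ∃ q : E →ₗ[ℝ] ℝ, ∀ x ∈ F, q x = f x := by
  set Φ : (F →₀ ℝ) →ₗ[ℝ] E := Finsupp.linearCombination ℝ Subtype.val
  set Ψ : (F →₀ ℝ) →ₗ[ℝ] ℝ := Finsupp.linearCombination ℝ fun x : F => f x
  -- A functional on formal combinations factors through `E` exactly when it kills the relations,
  -- that is, the kernel of `Φ`.
  have hΨ : Ψ ∈ Φ.ker.dualAnnihilator := by
    rw [Submodule.mem_dualAnnihilator]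
    intro c hc
    have hc : ∑ i ∈ c.support, c i • (i : E) = 0 := by
      simpa [Φ, Finsupp.linearCombination_apply, Finsupp.sum] using hc
    change Finsupp.linearCombination ℝ (fun x : F => f x) c = 0
    rw [Finsupp.linearCombination_apply, Finsupp.sum]
    have hsplit : ∀ i, c i = (c i)⁺ - (c i)⁻ := fun i => (posPart_sub_negPart _).symm
    have e1 : ∑ i ∈ c.support, (c i)⁺ • (i : E) = ∑ i ∈ c.support, (c i)⁻ • (i : E) := by
      rw [← sub_eq_zero, ← Finset.sum_sub_distrib, ← hc]
      exact Finset.sum_congr rfl fun i _ => by rw [← sub_smul, ← hsplit]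
    have e2 : ∑ i ∈ c.support, (c i)⁺ = ∑ i ∈ c.support, (c i)⁻ := by
      have := congrArg τ e1
      simpa [map_sum, hτ _ (Subtype.prop _)] using this
    have key : ∑ i ∈ c.support, (c i)⁺ * f i = ∑ i ∈ c.support, (c i)⁻ * f i := by
      -- The positive and negative parts of a relation have equal mass, by `τ`, and equal weighted
      -- sums. They thus have the same barycentre, unless both masses vanish.
      rcases (Finset.sum_nonneg fun i (_ : i ∈ c.support) => posPart_nonneg (c i)).eq_or_lt
        with h0 | h0
      · have z1 := (Finset.sum_eq_zero_iff_of_nonneg fun i _ => posPart_nonneg (c i)).mp h0.symm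
        have z2 := (Finset.sum_eq_zero_iff_of_nonneg fun i _ => negPart_nonneg (c i)).mp
          (e2.symm.trans h0.symm)
        exact Finset.sum_congr rfl fun i hi => by rw [z1 i hi, z2 i hi]
      · rw [map_sum_smul_of_convexOn_of_concaveOn hcv hcc (fun i _ => posPart_nonneg _) h0
            (fun i _ => i.2),
          map_sum_smul_of_convexOn_of_concaveOn hcv hcc (fun i _ => negPart_nonneg _) (e2 ▸ h0)
            (fun i _ => i.2), e1, e2]
    calc ∑ i ∈ c.support, c i • f i
        = ∑ i ∈ c.support, ((c i)⁺ * f i - (c i)⁻ * f i) :=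
          Finset.sum_congr rfl fun i _ => by rw [← sub_mul, ← hsplit, smul_eq_mul]
      _ = 0 := by rw [Finset.sum_sub_distrib, key, sub_self]
  rw [← LinearMap.range_dualMap_eq_dualAnnihilator_ker] at hΨ
  obtain ⟨q, hq⟩ := hΨ
  refine ⟨q, fun x hx => ?_⟩
  have := LinearMap.congr_fun hq (Finsupp.single ⟨x, hx⟩ 1)
  simpa [Φ, Ψ] using this

end Affine

/-! ### The operator trace as a faithful trace, and translation of the definitions. -/

section Trace

variable {H : Type*} [NormedAddCommGroup H] [InnerProductSpace ℂ H]

lemma opTrace_add (a b : H →L[ℂ] H) : opTrace (a + b) = opTrace a + opTrace b :=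
  map_add (LinearMap.trace ℂ H) (a : H →ₗ[ℂ] H) b

lemma opTrace_smul (c : ℝ) (a : H →L[ℂ] H) : opTrace (c • a) = c • opTrace a := by
  have := map_smul (LinearMap.trace ℂ H) (c : ℂ) (a : H →ₗ[ℂ] H)
  rw [Complex.coe_smul, Complex.coe_smul] at this
  exact this

variable [FiniteDimensional ℂ H]

variable [CompleteSpace H]

/-- In an eigenbasis, each nonnegative eigenvalue is at most the sum of all of them. -/
lemma isPositive_re_opTrace_smul_one_sub {a : H →L[ℂ] H} (ha : a.IsPositive) :
    ((opTrace a).re • (1 : H →L[ℂ] H) - a).IsPositive := by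
  have h1 : IsSelfAdjoint ((opTrace a).re • (1 : H →L[ℂ] H)) :=
    IsSelfAdjoint.smul (IsSelfAdjoint.all _) (IsSelfAdjoint.one _)
  rw [ContinuousLinearMap.isPositive_def']
  refine ⟨h1.sub ha.isSelfAdjoint, fun x => ?_⟩
  have hs : (a : H →ₗ[ℂ] H).IsSymmetric := ha.isSymmetric
  set b := hs.eigenvectorBasis rfl
  set μ := hs.eigenvalues rfl
  have hab : ∀ i, a (b i) = (μ i : ℂ) • b i := fun i => hs.apply_eigenvectorBasis rfl i
  have hμ : ∀ i, 0 ≤ μ i := fun i => by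
    have := ha.re_inner_nonneg_right (b i)
    rw [hab, inner_smul_right, inner_self_eq_norm_sq_to_K, b.norm_eq_one] at this
    simpa using this
  have htr : (opTrace a).re = ∑ i, μ i := by
    rw [opTrace, LinearMap.trace_eq_sum_inner _ b, Complex.re_sum]
    refine Finset.sum_congr rfl fun i _ => ?_
    rw [ContinuousLinearMap.coe_coe, hab, inner_smul_right, inner_self_eq_norm_sq_to_K,
      b.norm_eq_one]
    simp
  have hx : RCLike.re (inner ℂ (a x) x) = ∑ i, μ i * ‖inner ℂ (b i) x‖ ^ 2 := by
    rw [← b.sum_inner_mul_inner, map_sum]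
    refine Finset.sum_congr rfl fun i _ => ?_
    have : inner ℂ (a x) (b i) = (μ i : ℂ) * inner ℂ x (b i) := by
      rw [← inner_smul_right, ← hab]; exact hs x (b i)
    rw [this, mul_assoc, ← inner_conj_symm x, RCLike.conj_mul]
    change (((μ i : ℝ) : ℂ) * ((‖inner ℂ (b i) x‖ : ℝ) : ℂ) ^ 2).re = _
    rw [← Complex.ofReal_pow, ← Complex.ofReal_mul, Complex.ofReal_re]
  rw [ContinuousLinearMap.reApplyInnerSelf_apply, sub_apply,
    inner_sub_left, map_sub, hx, smul_apply, one_apply_eq_self,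
    inner_smul_left_eq_smul, RCLike.smul_re, inner_self_eq_norm_sq, htr,
    Finset.sum_mul, sub_nonneg]
  refine Finset.sum_le_sum fun i _ => mul_le_mul_of_nonneg_left ?_ (hμ i)
  rw [← b.sum_sq_norm_inner_right x]
  exact Finset.single_le_sum (f := fun i => ‖inner ℂ (b i) x‖ ^ 2) (fun _ _ => sq_nonneg _)
    (Finset.mem_univ i)

/-- The real part of the trace, as a continuous functional. -/
def reTrace (H : Type*) [NormedAddCommGroup H] [InnerProductSpace ℂ H]
    [FiniteDimensional ℂ H] : (H →L[ℂ] H) →L[ℝ] ℝ :=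
  haveI := FiniteDimensional.complexToReal (H →L[ℂ] H)
  LinearMap.toContinuousLinearMap
    { toFun := fun a => (opTrace a).re
      map_add' := fun a b => by rw [opTrace_add, Complex.add_re]
      map_smul' := fun c a => by rw [opTrace_smul, Complex.smul_re]; rfl }

omit [CompleteSpace H] in
lemma reTrace_apply (a : H →L[ℂ] H) : reTrace H a = (opTrace a).re := rfl

omit [CompleteSpace H] in
lemma opTrace_eq_reTrace {a : H →L[ℂ] H} (ha : 0 ≤ a) : opTrace a = reTrace H a := by
  have := LinearMap.IsPositive.trace_nonneg
    (((ContinuousLinearMap.nonneg_iff_isPositive a).mp ha).toLinearMap)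
  rw [Complex.le_def] at this
  exact Complex.ext rfl this.2.symm

lemma isFaithfulTrace_reTrace : IsFaithfulTrace (reTrace H) where
  map_mul_comm a b := by
    simp only [reTrace_apply]
    congr 1
    exact LinearMap.trace_mul_comm ℂ (a : H →ₗ[ℂ] H) b
  map_nonneg a ha := by
    have := LinearMap.IsPositive.trace_nonneg
      (((ContinuousLinearMap.nonneg_iff_isPositive a).mp ha).toLinearMap)
    exact (Complex.le_def.mp this).1
  le_smul_one a ha := by
    rw [ContinuousLinearMap.nonneg_iff_isPositive] at ha
    rw [ContinuousLinearMap.le_def]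
    exact isPositive_re_opTrace_smul_one_sub ha

omit [CompleteSpace H] in
lemma isState_iff {ω : H →L[ℂ] H} : IsState ω ↔ 0 ≤ ω ∧ reTrace H ω = 1 := by
  rw [IsState, ← ContinuousLinearMap.nonneg_iff_isPositive]
  refine and_congr_right fun h => ?_
  rw [opTrace_eq_reTrace h]
  exact Complex.ofReal_eq_one

lemma entropy_eq (ω : H →L[ℂ] H) : entropy ω = -reTrace H (ω * CFC.log ω) := rfl

omit [FiniteDimensional ℂ H] [CompleteSpace H] in
lemma mix_eq (φ ρ : H →L[ℂ] H) (l : ℝ) : mix φ ρ l = φ + l • (ρ - φ) := by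
  rw [mix]; module

omit [FiniteDimensional ℂ H] in
lemma evolve_eq (𝓛 : (H →L[ℂ] H) →L[ℂ] (H →L[ℂ] H)) (t : ℝ) (a : H →L[ℂ] H) :
    evolve 𝓛 t a = flow 𝓛 t a := rfl

omit [FiniteDimensional ℂ H] in
lemma IsLindbladian.hasLindbladForm {𝓛 : (H →L[ℂ] H) →L[ℂ] (H →L[ℂ] H)} (h : IsLindbladian 𝓛) :
    HasLindbladForm 𝓛 := h

lemma mul_kerProj_eq_zero_of_supp_le {φ ρ : H →L[ℂ] H} (hφ : IsSelfAdjoint φ)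
    (h : supp ρ ≤ supp φ) : ρ * kerProj φ = 0 := by
  have hk : LinearMap.ker (φ : H →ₗ[ℂ] H) ≤ LinearMap.ker (ρ : H →ₗ[ℂ] H) := by
    have := Submodule.orthogonal_le h
    rwa [supp, supp, Submodule.orthogonal_orthogonal, Submodule.orthogonal_orthogonal] at this
  ext x
  refine LinearMap.mem_ker.mp (hk (LinearMap.mem_ker.mpr ?_))
  exact congrArg (fun T : H →L[ℂ] H => T x) (mul_kerProj hφ)

omit [FiniteDimensional ℂ H] in
lemma supp_le_of_relEntropy {φ ρ : H →L[ℂ] H} (h : relEntropy ρ φ < ⊤) : supp ρ ≤ supp φ := by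
  by_contra hs
  rw [relEntropy, if_neg hs] at h
  exact lt_irrefl _ h

end Trace

/-! ### Entropy rates of states. -/

section Rates

variable {H : Type*} [NormedAddCommGroup H] [InnerProductSpace ℂ H] [CompleteSpace H]
  [FiniteDimensional ℂ H] {𝓛 : (H →L[ℂ] H) →L[ℂ] (H →L[ℂ] H)} {Q : (H →L[ℂ] H) → EReal}
  {φ ρ ω σ : H →L[ℂ] H}

lemma IsState.le_one (h : IsState ω) : ω ≤ 1 :=
  isFaithfulTrace_reTrace.le_one (isState_iff.mp h).1 (isState_iff.mp h).2

lemma IsLindbladian.isState_flow (h : IsLindbladian 𝓛) (hω : IsState ω) {t : ℝ} (ht : 0 ≤ t) :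
    IsState (flow 𝓛 t ω) := by
  rw [isState_iff] at hω ⊢
  refine ⟨h.hasLindbladForm.flow_nonneg ht hω.1, ?_⟩
  rw [map_flow (h.hasLindbladForm.map_eq_zero isFaithfulTrace_reTrace.map_mul_comm), hω.2]

omit [CompleteSpace H] in
lemma isState_line (hφ : IsState φ) (hρ : IsState ρ) {l : ℝ} (h : 0 ≤ φ + l • (ρ - φ)) :
    IsState (φ + l • (ρ - φ)) :=
  isState_iff.mpr ⟨h, map_line (isState_iff.mp hφ).2 (isState_iff.mp hρ).2 l⟩

omit [CompleteSpace H] in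
lemma isState_mix (hω : IsState ω) (hσ : IsState σ) {l : ℝ} (h0 : 0 ≤ l) (h1 : l ≤ 1) :
    IsState (mix ω σ l) := by
  have : 0 ≤ mix ω σ l :=
    add_nonneg (smul_nonneg (sub_nonneg.mpr h1) (isState_iff.mp hω).1)
      (smul_nonneg h0 (isState_iff.mp hσ).1)
  rw [mix_eq] at this ⊢
  exact isState_line hω hσ this

lemma IsLindbladian.hasDerivWithinAt_entropy (h : IsLindbladian 𝓛) (hω : IsState ω)
    (h0 : reTrace H (𝓛 ω * kerProj ω) = 0) :
    HasDerivWithinAt (fun t : ℝ => entropy (evolve 𝓛 t ω)) (-reTrace H (𝓛 ω * CFC.log ω))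
      (Ici 0) 0 :=
  hasDerivWithinAt_Ioi_iff_Ici.mp (h.hasLindbladForm.hasDerivWithinAt_flow isFaithfulTrace_reTrace
    (isState_iff.mp hω).1 hω.le_one h0).neg

lemma IsLindbladian.entropyRate_eq (h : IsLindbladian 𝓛) (hω : IsState ω)
    (h0 : reTrace H (𝓛 ω * kerProj ω) = 0) :
    entropyRate 𝓛 ω = ((-reTrace H (𝓛 ω * CFC.log ω) : ℝ) : EReal) := by
  have h1 := (h.hasDerivWithinAt_entropy hω h0).Ioi_of_Ici
  rw [hasDerivWithinAt_iff_tendsto_slope' (by simp)] at h1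
  refine Tendsto.limUnder_eq ((continuous_coe_real_ereal.tendsto _).comp (h1.congr fun t => ?_))
  rw [slope_def_field, sub_zero, evolve_eq, evolve_eq, flow_zero]

lemma IsLindbladian.entropyRate_eq_top (h : IsLindbladian 𝓛) (hω : IsState ω)
    (h0 : reTrace H (𝓛 ω * kerProj ω) ≠ 0) : entropyRate 𝓛 ω = ⊤ := by
  have h1 := h.hasLindbladForm.tendsto_slope_flow_atTop isFaithfulTrace_reTrace
    (isState_iff.mp hω).1 hω.le_one h0
  refine Tendsto.limUnder_eq ((EReal.tendsto_coe_nhds_top_iff).mpr (h1.congr fun t => ?_))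
  rw [evolve_eq, entropy_eq, entropy_eq]
  ring

/-- Neither summand of the EP rate can be `⊥`, so an infinite one cannot be compensated. -/
lemma IsLindbladian.of_epRate_lt_top (h : IsLindbladian 𝓛) (hQ : IsEntropyFlow Q) (hω : IsState ω)
    (hlt : epRate 𝓛 Q ω < ⊤) : reTrace H (𝓛 ω * kerProj ω) = 0 ∧ Q ω < ⊤ := by
  have h1 : reTrace H (𝓛 ω * kerProj ω) = 0 := by
    by_contra h0
    rw [epRate, h.entropyRate_eq_top hω h0, EReal.top_add_of_ne_bot (hQ.1 ω hω)] at hlt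
    exact lt_irrefl _ hlt
  refine ⟨h1, lt_top_iff_ne_top.mpr fun hq => ?_⟩
  rw [epRate, h.entropyRate_eq hω h1, hq, EReal.coe_add_top] at hlt
  exact lt_irrefl _ hlt

end Rates

/-! ### Linearity and finiteness of the entropy flow. -/

section EntropyFlow

variable {H : Type*} [NormedAddCommGroup H] [InnerProductSpace ℂ H]
  {Q : (H →L[ℂ] H) → EReal} {φ ρ ω σ : H →L[ℂ] H}

lemma IsEntropyFlow.right_lt_top (hQ : IsEntropyFlow Q) (hω : IsState ω) (hσ : IsState σ) {l : ℝ}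
    (h0 : 0 < l) (h1 : l < 1) (h : Q (mix ω σ l) < ⊤) : Q σ < ⊤ := by
  refine lt_top_iff_ne_top.mpr fun hq => ?_
  rw [hQ.2 ω σ hω hσ l h0 h1, hq, EReal.coe_mul_top_of_pos h0, EReal.add_top_of_ne_bot] at h
  · exact lt_irrefl _ h
  · have := hQ.1 ω hω
    have h1 : 0 < 1 - l := by linarith
    induction hω' : Q ω with
    | bot => exact absurd hω' this
    | coe x => rw [← EReal.coe_mul]; exact EReal.coe_ne_bot _
    | top => rw [EReal.coe_mul_top_of_pos h1]; simp

variable [FiniteDimensional ℂ H]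

/-- On the states where it is finite, an entropy flow is the restriction of a linear functional. -/
lemma IsEntropyFlow.exists_clm (hQ : IsEntropyFlow Q) :
    ∃ q : (H →L[ℂ] H) →L[ℝ] ℝ, ∀ ω, IsState ω → Q ω < ⊤ → Q ω = (q ω : EReal) := by
  set F : Set (H →L[ℂ] H) := {ω | IsState ω ∧ Q ω < ⊤}
  have hF : ∀ ω ∈ F, Q ω = ((Q ω).toReal : EReal) := fun ω hω =>
    (EReal.coe_toReal hω.2.ne (hQ.1 ω hω.1)).symm
  have hmix : ∀ ω ∈ F, ∀ σ ∈ F, ∀ a b : ℝ, 0 < a → 0 < b → a + b = 1 →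
      a • ω + b • σ ∈ F ∧ (Q (a • ω + b • σ)).toReal = a * (Q ω).toReal + b * (Q σ).toReal := by
    intro ω hω σ hσ a b ha hb hab
    obtain rfl : a = 1 - b := by linarith
    have e := hQ.2 ω σ hω.1 hσ.1 b hb (by linarith)
    rw [hF ω hω, hF σ hσ, ← EReal.coe_mul, ← EReal.coe_mul, ← EReal.coe_add] at e
    refine ⟨⟨isState_mix hω.1 hσ.1 hb.le (by linarith), ?_⟩, ?_⟩
    · exact e ▸ EReal.coe_lt_top _
    · exact (congrArg EReal.toReal e).trans (EReal.toReal_coe _)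
  have hconv : Convex ℝ F := convex_iff_forall_pos.mpr fun ω hω σ hσ a b ha hb hab =>
    (hmix ω hω σ hσ a b ha hb hab).1
  obtain ⟨q, hq⟩ := exists_linearMap_eq_of_convexOn_of_concaveOn (F := F)
    (f := fun ω => (Q ω).toReal)
    (convexOn_iff_forall_pos.mpr ⟨hconv, fun ω hω σ hσ a b ha hb hab =>
      (hmix ω hω σ hσ a b ha hb hab).2.le⟩)
    (concaveOn_iff_forall_pos.mpr ⟨hconv, fun ω hω σ hσ a b ha hb hab =>
      (hmix ω hω σ hσ a b ha hb hab).2.ge⟩)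
    (reTrace H : (H →L[ℂ] H) →ₗ[ℝ] ℝ) (fun ω hω => (isState_iff.mp hω.1).2)
  have := FiniteDimensional.complexToReal (H →L[ℂ] H)
  refine ⟨q.toContinuousLinearMap, fun ω hω hlt => ?_⟩
  rw [LinearMap.coe_toContinuousLinearMap', hq ω ⟨hω, hlt⟩]
  exact hF ω ⟨hω, hlt⟩

variable [CompleteSpace H]

/-- Domination exhibits `φ` as a proper mixture of another state with `σ`, and an infinite value at
`σ` would make `Q φ` infinite. -/
lemma IsEntropyFlow.lt_top_of_le (hQ : IsEntropyFlow Q) (hφ : IsState φ) (hσ : IsState σ) {C : ℝ}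
    (hC : σ ≤ C • φ) (h : Q φ < ⊤) : Q σ < ⊤ := by
  obtain ⟨hφ0, hφ1⟩ := isState_iff.mp hφ
  obtain ⟨hσ0, hσ1⟩ := isState_iff.mp hσ
  -- Weight of `σ` in the mixture: small enough for both `c < 1` and `c * C ≤ 1`, whatever the sign
  -- of `C`.
  set c : ℝ := (|C| + 2)⁻¹ with hc
  have hpos : 0 < |C| + 2 := by positivity
  have hc0 : 0 < c := inv_pos.mpr hpos
  have hc1 : c < 1 := inv_lt_one_of_one_lt₀ (by linarith [abs_nonneg C])
  have hcC : c * C ≤ 1 := by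
    rw [hc, inv_mul_le_one₀ hpos]
    linarith [le_abs_self C]
  have hd : 0 < 1 - c := by linarith
  have hle : c • σ ≤ φ := by
    calc c • σ ≤ c • (C • φ) := smul_le_smul_of_nonneg_left hC hc0.le
      _ = (c * C) • φ := smul_smul _ _ _
      _ ≤ (1 : ℝ) • φ := smul_le_smul_of_nonneg_right hcC hφ0
      _ = φ := one_smul _ _
  have hξ : IsState ((1 - c)⁻¹ • (φ - c • σ)) := by
    refine isState_iff.mpr ⟨smul_nonneg (inv_nonneg.mpr hd.le) (sub_nonneg.mpr hle), ?_⟩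
    rw [map_smul, map_sub, map_smul, hφ1, hσ1, smul_eq_mul, smul_eq_mul, mul_one,
      inv_mul_cancel₀ hd.ne']
  refine hQ.right_lt_top hξ hσ hc0 hc1 ?_
  rwa [mix, smul_smul, mul_inv_cancel₀ hd.ne', one_smul, sub_add_cancel]

end EntropyFlow

/-! ### The two conditions. -/

section Main

variable {H : Type*} [NormedAddCommGroup H] [InnerProductSpace ℂ H] [CompleteSpace H]
  [FiniteDimensional ℂ H] {𝓛 : (H →L[ℂ] H) →L[ℂ] (H →L[ℂ] H)} {Q : (H →L[ℂ] H) → EReal}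
  {φ ρ ω : H →L[ℂ] H} {q : (H →L[ℂ] H) →L[ℝ] ℝ}

lemma IsLindbladian.finiteEPRate (h : IsLindbladian 𝓛)
    (hq : ∀ ω, IsState ω → Q ω < ⊤ → Q ω = (q ω : EReal)) (hω : IsState ω)
    (h0 : reTrace H (𝓛 ω * kerProj ω) = 0) (hlt : Q ω < ⊤) :
    FiniteEPRate 𝓛 Q ω ∧
      (epRate 𝓛 Q ω).toReal = -reTrace H (𝓛 ω * CFC.log ω) + q ω := by
  have e : epRate 𝓛 Q ω = ((-reTrace H (𝓛 ω * CFC.log ω) + q ω : ℝ) : EReal) := by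
    rw [epRate, h.entropyRate_eq hω h0, hq ω hω hlt, EReal.coe_add]
  refine ⟨⟨(h.hasDerivWithinAt_entropy hω h0).differentiableWithinAt, ?_, ?_⟩, ?_⟩
  · rw [e]; exact EReal.coe_ne_bot _
  · rw [e]; exact EReal.coe_ne_top _
  · rw [e, EReal.toReal_coe]

omit [FiniteDimensional ℂ H] in
lemma line_le {C l : ℝ} (hφ : 0 ≤ φ) (hρ : 0 ≤ ρ) (hC : ρ ≤ C • φ) (hl : |l| ≤ 1) :
    φ + l • (ρ - φ) ≤ (2 + C) • φ := by
  have hl' := abs_le.mp hl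
  calc φ + l • (ρ - φ) = (1 - l) • φ + l • ρ := by module
    _ ≤ (2 : ℝ) • φ + (1 : ℝ) • ρ :=
      add_le_add (smul_le_smul_of_nonneg_right (by linarith) hφ)
        (smul_le_smul_of_nonneg_right hl'.2 hρ)
    _ ≤ (2 : ℝ) • φ + C • φ := by rw [one_smul]; exact add_le_add_right hC _
    _ = (2 + C) • φ := (add_smul _ _ _).symm

lemma IsEntropyFlow.flow_line_lt_top (hQ : IsEntropyFlow Q) (h : IsLindbladian 𝓛)
    (hφ : IsState φ) (hρ : IsState ρ) (hρφ : ρ * kerProj φ = 0) {l : ℝ} (hl : |l| ≤ 1)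
    (hst : IsState (φ + l • (ρ - φ))) {s : ℝ} (hs : 0 ≤ s) (hlt : Q (flow 𝓛 s φ) < ⊤) :
    Q (flow 𝓛 s (φ + l • (ρ - φ))) < ⊤ := by
  obtain ⟨C, _, hC⟩ := exists_le_smul_of_mul_kerProj (isState_iff.mp hφ).1
    (isState_iff.mp hρ).1.isSelfAdjoint hρφ
  have hle := line_le (isState_iff.mp hφ).1 (isState_iff.mp hρ).1 hC hl
  have := h.hasLindbladForm.flow_nonneg hs (sub_nonneg.mpr hle)
  rw [flow_map_sub, flow_map_smul, sub_nonneg] at this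
  exact hQ.lt_top_of_le (h.isState_flow hφ hs) (h.isState_flow hst hs) this hlt

/-- Along the evolution of a state on the segment, the EP rate is finite. -/
lemma IsLindbladian.finiteEPRate_flow_line (h : IsLindbladian 𝓛) (hQ : IsEntropyFlow Q)
    (hq : ∀ ω, IsState ω → Q ω < ⊤ → Q ω = (q ω : EReal)) (hφ : IsState φ) (hρ : IsState ρ)
    (hρφ : ρ * kerProj φ = 0) (h0 : reTrace H (𝓛 φ * kerProj φ) = 0) {l : ℝ} (hl1 : |l| ≤ 1)
    (hl : (1 / 2 : ℝ) • φ ≤ φ + l • (ρ - φ)) {s : ℝ} (hs : 0 ≤ s) (hlt : Q (flow 𝓛 s φ) < ⊤) :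
    FiniteEPRate 𝓛 Q (flow 𝓛 s (φ + l • (ρ - φ))) ∧
      (epRate 𝓛 Q (flow 𝓛 s (φ + l • (ρ - φ)))).toReal =
        flowRate 𝓛 (reTrace H) (φ + l • (ρ - φ)) s + q (flow 𝓛 s (φ + l • (ρ - φ))) := by
  have hφ0 := (isState_iff.mp hφ).1
  have hst := isState_line hφ hρ (line_nonneg hφ0 hl)
  refine h.finiteEPRate hq (h.isState_flow hst hs) ?_
    (hQ.flow_line_lt_top h hφ hρ hρφ hl1 hst hs hlt)
  -- At time `0` the vanishing flow into the kernel is inherited from `φ` by domination; at positive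
  -- times it is automatic.
  rcases hs.eq_or_lt with rfl | hs
  · rw [flow_zero]
    exact h.hasLindbladForm.map_mul_kerProj_line isFaithfulTrace_reTrace hφ0 hρφ h0 hl
  · exact h.hasLindbladForm.map_mul_kerProj_flow isFaithfulTrace_reTrace (line_nonneg hφ0 hl) hs

/-- On the segment itself, the EP rate is given by the power series of the logarithm. -/
lemma IsLindbladian.epRate_line (h : IsLindbladian 𝓛) (hQ : IsEntropyFlow Q)
    (hq : ∀ ω, IsState ω → Q ω < ⊤ → Q ω = (q ω : EReal)) (hφ : IsState φ) (hρ : IsState ρ)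
    (hρφ : ρ * kerProj φ = 0) (h0 : reTrace H (𝓛 φ * kerProj φ) = 0) {l : ℝ} (hl1 : |l| ≤ 1)
    (hl : (1 / 2 : ℝ) • φ ≤ φ + l • (ρ - φ)) (hlt : Q φ < ⊤) :
    FiniteEPRate 𝓛 Q (mix φ ρ l) ∧
      (epRate 𝓛 Q (mix φ ρ l)).toReal =
        -reTrace H (𝓛 (φ + l • (ρ - φ)) * logSeries (φ + l • (ρ - φ) + kerProj φ)) +
          (q φ + l * q (ρ - φ)) := by
  have := h.finiteEPRate_flow_line hQ hq hφ hρ hρφ h0 hl1 hl le_rfl (by rwa [flow_zero])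
  rw [flowRate, flow_zero, ← mix_eq] at this
  refine ⟨this.1, this.2.trans ?_⟩
  rw [mix_eq, log_line isFaithfulTrace_reTrace (isState_iff.mp hφ).1 (isState_iff.mp hφ).2
    (isState_iff.mp hρ).2 hρφ hl, map_add q, map_smul q, smul_eq_mul]

lemma IsLindbladian.condition2 (h : IsLindbladian 𝓛) (hQ : IsEntropyFlow Q)
    (hφ : IsState φ) (hρ : IsState ρ) (hρφ : ρ * kerProj φ = 0)
    (h0 : reTrace H (𝓛 φ * kerProj φ) = 0) (hlt : Q φ < ⊤) : Condition2 𝓛 Q φ ρ := by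
  intro _
  obtain ⟨q, hq⟩ := hQ.exists_clm
  obtain ⟨hφ0, hφ1⟩ := isState_iff.mp hφ
  obtain ⟨hρ0, hρ1⟩ := isState_iff.mp hρ
  obtain ⟨ε, hε0, hε1, hε⟩ := exists_half_le_line hφ0 hρ0 hρφ
  have habs : ∀ l ∈ Ioo (-ε) ε, |l| ≤ ε := fun l hl => (abs_lt.mpr hl).le
  have key := fun l (hl : l ∈ Ioo (-ε) ε) => h.epRate_line hQ hq hφ hρ hρφ h0
    ((habs l hl).trans hε1.le) (hε l (habs l hl)) hlt
  refine ⟨ε, hε0, fun l hl => ⟨?_, (key l hl).1⟩, ?_⟩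
  · rw [mix_eq]
    exact isState_line hφ hρ (line_nonneg hφ0 (hε l (habs l hl)))
  · refine ((contDiffOn_rate_line 𝓛 (reTrace H) fun l hl =>
      norm_one_sub_line_add_lt isFaithfulTrace_reTrace hφ0 hφ1 hρ1 hρφ (hε l (habs l hl))).add
      (g := fun l => q φ + l * q (ρ - φ)) ?_).congr fun l hl => (key l hl).2
    fun_prop

omit [FiniteDimensional ℂ H] in
lemma continuous_map_flow (𝓛 : (H →L[ℂ] H) →L[ℂ] (H →L[ℂ] H)) (q : (H →L[ℂ] H) →L[ℝ] ℝ)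
    (a : H →L[ℂ] H) : Continuous fun s => q (flow 𝓛 s a) :=
  q.continuous.comp (continuous_flow 𝓛 a)

/-- The integral of the entropy rate telescopes, leaving an entropy difference and a part affine in
`l`, so differentiating in `l` never requires differentiating under the integral of the rate. -/
lemma IsLindbladian.integratedEP_line (h : IsLindbladian 𝓛) (hφ : IsState φ) (hρ : IsState ρ)
    {l T : ℝ} (h0 : 0 ≤ φ + l • (ρ - φ)) (hT : 0 ≤ T)
    (heq : ∀ s ∈ Icc 0 T, (epRate 𝓛 Q (flow 𝓛 s (φ + l • (ρ - φ)))).toReal =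
        flowRate 𝓛 (reTrace H) (φ + l • (ρ - φ)) s + q (flow 𝓛 s (φ + l • (ρ - φ)))) :
    IntervalIntegrable (fun s => (epRate 𝓛 Q (evolve 𝓛 s (mix φ ρ l))).toReal) volume 0 T ∧
      integratedEP 𝓛 Q (mix φ ρ l) T =
        -reTrace H (flow 𝓛 T (φ + l • (ρ - φ)) * CFC.log (flow 𝓛 T (φ + l • (ρ - φ)))) -
          -reTrace H (flow 𝓛 0 (φ + l • (ρ - φ)) * CFC.log (flow 𝓛 0 (φ + l • (ρ - φ)))) +
          ((∫ s in (0 : ℝ)..T, q (flow 𝓛 s φ)) + l * ∫ s in (0 : ℝ)..T, q (flow 𝓛 s (ρ - φ))) := by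
  have hst := isState_line hφ hρ h0
  obtain ⟨hi, he⟩ := h.hasLindbladForm.integral_flowRate isFaithfulTrace_reTrace
    (isState_iff.mp hst).1 (isState_iff.mp hst).2 hT
  have hqi : ∀ a : H →L[ℂ] H, IntervalIntegrable (fun s => q (flow 𝓛 s a)) volume 0 T :=
    fun a => (continuous_map_flow 𝓛 q a).intervalIntegrable 0 T
  constructor
  · refine (hi.add (hqi (φ + l • (ρ - φ)))).congr fun s hs => ?_
    rw [uIoc_of_le hT] at hs
    rw [mix_eq, evolve_eq]
    exact (heq s ⟨hs.1.le, hs.2⟩).symm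
  · have e1 : integratedEP 𝓛 Q (mix φ ρ l) T = ∫ s in (0 : ℝ)..T,
        (flowRate 𝓛 (reTrace H) (φ + l • (ρ - φ)) s + q (flow 𝓛 s (φ + l • (ρ - φ)))) := by
      refine intervalIntegral.integral_congr fun s hs => ?_
      rw [uIcc_of_le hT] at hs
      rw [← heq s hs, ← mix_eq, evolve_eq]
    have e2 : ∫ s in (0 : ℝ)..T, q (flow 𝓛 s (φ + l • (ρ - φ))) =
        (∫ s in (0 : ℝ)..T, q (flow 𝓛 s φ)) + l * ∫ s in (0 : ℝ)..T, q (flow 𝓛 s (ρ - φ)) := by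
      rw [← intervalIntegral.integral_const_mul,
        ← intervalIntegral.integral_add (hqi φ) ((hqi (ρ - φ)).const_mul l)]
      refine intervalIntegral.integral_congr fun s _ => ?_
      simp only [flow_map_add, flow_map_smul, map_add q, map_smul q, smul_eq_mul]
    rw [e1, intervalIntegral.integral_add hi (hqi _), he, e2, flow_zero]
    ring

lemma IsLindbladian.condition1 (h : IsLindbladian 𝓛) (hQ : IsEntropyFlow Q)
    (hφ : IsState φ) (hρ : IsState ρ) (hρφ : ρ * kerProj φ = 0)
    (h0 : reTrace H (𝓛 φ * kerProj φ) = 0) (hlt : Q φ < ⊤)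
    (hev : ∀ᶠ t in 𝓝[>] (0 : ℝ), Q (evolve 𝓛 t φ) < ⊤) : Condition1 𝓛 Q φ ρ := by
  obtain ⟨q, hq⟩ := hQ.exists_clm
  obtain ⟨hφ0, hφ1⟩ := isState_iff.mp hφ
  obtain ⟨hρ0, hρ1⟩ := isState_iff.mp hρ
  obtain ⟨ε, hε0, hε1, hε⟩ := exists_half_le_line hφ0 hρ0 hρφ
  obtain ⟨T, hT0, hT⟩ := mem_nhdsGT_iff_exists_Ioc_subset.mp hev
  have hT0 : 0 < T := hT0
  have hQs : ∀ s ∈ Icc 0 T, Q (flow 𝓛 s φ) < ⊤ := by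
    rintro s ⟨hs0, hsT⟩
    -- The eventual hypothesis covers positive times only; time `0` comes from `hlt`.
    rcases hs0.eq_or_lt with rfl | hs0
    · rwa [flow_zero]
    · exact hT ⟨hs0, hsT⟩
  have habs : ∀ l ∈ Icc 0 ε, |l| ≤ ε := fun l hl => by rw [abs_of_nonneg hl.1]; exact hl.2
  have hpos : ∀ l ∈ Icc 0 ε, 0 ≤ φ + l • (ρ - φ) := fun l hl =>
    line_nonneg hφ0 (hε l (habs l hl))
  have key := fun l (hl : l ∈ Icc 0 ε) s (hs : s ∈ Icc 0 T) => h.finiteEPRate_flow_line hQ hq hφ hρ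
    hρφ h0 ((habs l hl).trans hε1.le) (hε l (habs l hl)) hs.1 (hQs s hs)
  have key' := fun t (ht : t ∈ Icc 0 T) l (hl : l ∈ Icc 0 ε) =>
    h.integratedEP_line hφ hρ (hpos l hl) ht.1 fun s hs =>
      (key l hl s ⟨hs.1, hs.2.trans ht.2⟩).2
  have hev0 : ∀ᶠ l in 𝓝[≥] (0 : ℝ), l ∈ Icc 0 ε := Icc_mem_nhdsGE hε0
  have hmem : (0 : ℝ) ∈ Icc 0 ε := ⟨le_rfl, hε0.le⟩
  have hlin : ∀ a b : ℝ, HasDerivWithinAt (fun l : ℝ => a + l * b) b (Ici 0) 0 := fun a b => by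
    simpa using (((hasDerivAt_id (0 : ℝ)).mul_const b).const_add a).hasDerivWithinAt (s := Ici 0)
  -- The witness `g` is the `l`-derivative of the formula in `integratedEP_line`: the derivative of
  -- the entropy at time `t`, minus that at time `0`, plus the integrated linear flow.
  refine ⟨T, ε, rateDeriv 𝓛 (reTrace H) φ ρ + q (ρ - φ),
    fun t => -reTrace H (flow 𝓛 t (ρ - φ) * CFC.log (flow 𝓛 t φ)) -
      -reTrace H (flow 𝓛 0 (ρ - φ) * CFC.log (flow 𝓛 0 φ)) +
      ∫ s in (0 : ℝ)..t, q (flow 𝓛 s (ρ - φ)), hT0, hε0, fun l hl => ⟨fun s hs => ?_, ?_⟩, ?_,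
      fun t ht => ?_, ?_⟩
  · rw [mix_eq, evolve_eq]
    exact (key l hl s hs).1
  · exact (key' T ⟨hT0.le, le_rfl⟩ l hl).1
  · have e := fun l (hl : l ∈ Icc 0 ε) => (h.epRate_line hQ hq hφ hρ hρφ h0
      ((habs l hl).trans hε1.le) (hε l (habs l hl)) hlt).2
    refine HasDerivWithinAt.congr_of_eventuallyEq
      ((hasDerivAt_rate_line 𝓛 isFaithfulTrace_reTrace hφ0 hφ1).hasDerivWithinAt.add
        (hlin (q φ) (q (ρ - φ)))) (hev0.mono fun l hl => e l hl) (e 0 hmem)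
  · have d := fun t (ht : (0 : ℝ) ≤ t) => hasDerivWithinAt_Ioi_iff_Ici.mp
      (h.hasLindbladForm.hasDerivWithinAt_line isFaithfulTrace_reTrace hφ0 hφ1 hρ0 hρ1 hρφ ht)
    exact HasDerivWithinAt.congr_of_eventuallyEq
      (((d t ht.1).sub (d 0 le_rfl)).add (hlin _ _))
      (hev0.mono fun l hl => (key' t ht l hl).2) (key' t ht 0 hmem).2
  · have d1 := hasDerivWithinAt_Ioi_iff_Ici.mp
      (h.hasLindbladForm.hasDerivWithinAt_mixed isFaithfulTrace_reTrace hφ0 hφ1 hρ0 hρφ h0)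
    have d2 := ((continuous_map_flow 𝓛 q (ρ - φ)).integral_hasStrictDerivAt 0 0).hasDerivAt
    rw [flow_zero] at d2
    exact (d1.sub_const _).add d2.hasDerivWithinAt

end Main

end QuantumEP

end

theorem mainTheorem9 {H : Type*} [NormedAddCommGroup H] [InnerProductSpace ℂ H] [CompleteSpace H]
    [FiniteDimensional ℂ H]
    (𝓛 : (H →L[ℂ] H) →L[ℂ] (H →L[ℂ] H)) (h𝓛 : QuantumEP.IsLindbladian 𝓛)
    (Q : (H →L[ℂ] H) → EReal) (hQ : QuantumEP.IsEntropyFlow Q)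
    (φ ρ : H →L[ℂ] H) (hφ : QuantumEP.IsState φ) (hρ : QuantumEP.IsState ρ)
    (hφ_rate : QuantumEP.epRate 𝓛 Q φ < ⊤) (hρ_rate : QuantumEP.epRate 𝓛 Q ρ < ⊤)
    (hrel : QuantumEP.relEntropy ρ φ < ⊤) :
    ((∀ᶠ t in 𝓝[>] (0 : ℝ), Q (QuantumEP.evolve 𝓛 t φ) < ⊤) →
      QuantumEP.Condition1 𝓛 Q φ ρ) ∧
    QuantumEP.Condition2 𝓛 Q φ ρ := by
  obtain ⟨h0, hlt⟩ := h𝓛.of_epRate_lt_top hQ hφ hφ_rate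
  have hρφ := QuantumEP.mul_kerProj_eq_zero_of_supp_le
    (QuantumEP.isState_iff.mp hφ).1.isSelfAdjoint (QuantumEP.supp_le_of_relEntropy hrel)
  exact ⟨h𝓛.condition1 hQ hφ hρ hρφ h0 hlt, h𝓛.condition2 hQ hφ hρ hρφ h0 hlt⟩
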